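/- Let $k,q\ge 1$ be integers and let $\pi=(\pi(x,y))_{x,y\in\{1,\dots,q\}}$ be a symmetric stochastic matrix ($\pi(x,y)\ge 0$, $\sum_y\pi(x,y)=1$, $\pi(x,y)=\pi(y,x)$). Call $\pi$ *frustrated* if $\pi(x,y)=\pi_*-\widehat\pi(x,y)$ for some constant $\pi_*\in\mathbb R$ and some positive-definite matrix $\widehat\pi$. *Broadcast.* On the infinite $k$-ary tree the root receives a uniformly random color $X_0\in\{1,\dots,q\}$; given the colors up to generation $\ell$, the colors of generation $\ell+1$ are conditionally independent, a child of a vertex of color $y$ having color $z$ with probability $\pi(y,z)$. Let $\underline X_\ell$ be the configuration of colors at generation $\ell$ and let $I_\ell=I(X_0;\underline X_\ell)$ be the mutual information. The reconstruction problem is *solvable* if $\lim_{\ell\to\infty}I_\ell$ exists and is strictly positive. *Complexity.* Let $\mathfrak M_q$ be the simplex of probability distributions on $\{1,\dots,q\}$ and let $\overline\eta(x)=1/q$. A Borel probability measure $\widehat Q$ on $\mathfrak M_q$ is *consistent* if $\int\eta(x)\,d\widehat Q(\eta)=1/q$ for every $x$. Put $$e(\eta_1,\eta_2)=\sum_{x_1,x_2}\eta_1(x_1)\eta_2(x_2)\pi(x_1,x_2),\qquad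 v(\eta_1,\dots,\eta_{k+1})=\sum_x\prod_{i=1}^{k+1}\sum_{x_i}\eta_i(x_i)\pi(x,x_i),$$ $$\widehat W_{\rm e}=-\frac{e(\eta_1,\eta_2)}{e(\overline\eta,\overline\eta)}\log\frac{e(\eta_1,\eta_2)}{e(\overline\eta,\overline\eta)},\qquad \widehat W_{\rm v}=-\frac{v(\eta_1,\dots,\eta_{k+1})}{v(\overline\eta,\dots,\overline\eta)}\log\frac{v(\eta_1,\dots,\eta_{k+1})}{v(\overline\eta,\dots,\overline\eta)}$$ (with $0\log 0=0$), and $$\Sigma(\widehat Q)=-\frac{k+1}{2}\int\widehat W_{\rm e}(\eta_1,\eta_2)\,d\widehat Q(\eta_1)\,d\widehat Q(\eta_2)+\int\widehat W_{\rm v}(\eta_1,\dots,\eta_{k+1})\prod_{i=1}^{k+1}d\widehat Q(\eta_i).$$ **Proposition.** If $\pi$ is frustrated and there exists a consistent distribution $\widehat Q$ over $\mathfrak M_q$ with $\Sigma(\widehat Q)<0$, then the reconstruction problem for the $k$-ary tree and the kernel $\pi$ is solvable. Moreover, for $q\ge2$ and $1-\frac1q<\varepsilon\le1$, the antiferromagnetic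 Potts kernel ($\pi(x,x)=1-\varepsilon$ and $\pi(x,y)=\varepsilon/(q-1)$ for $y\ne x$) is a symmetric stochastic matrix and is frustrated, so the above applies to it. -/

import Mathlib

open MeasureTheory Filter Topology

noncomputable section

namespace TreeReconstruction

/-- A reversible channel on the alphabet `Fin q`: a stochastic matrix, `π x y` being the probability
of receiving `y` when `x` is sent, which satisfies detailed balance for the uniform distribution. -/
structure IsReversibleChannel {q : ℕ} (π : Matrix (Fin q) (Fin q) ℝ) : Prop where
  nonneg : ∀ x y, 0 ≤ π x y
  sum_eq_one : ∀ x, ∑ y, π x y = 1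
  symm : ∀ x y, π x y = π y x

/-- A kernel is frustrated if it is a constant minus a positive-definite matrix. -/
def IsFrustrated {q : ℕ} (π : Matrix (Fin q) (Fin q) ℝ) : Prop :=
  ∃ (c : ℝ) (A : Matrix (Fin q) (Fin q) ℝ), A.PosDef ∧ ∀ x y, π x y = c - A x y

/-- The `q`-ary symmetric (Potts) channel with error probability `ε`. -/
def pottsChannel (q : ℕ) (ε : ℝ) : Matrix (Fin q) (Fin q) ℝ :=
  fun x y => if y = x then 1 - ε else ε / ((q : ℝ) - 1)

/-! ### The broadcast process and the reconstruction problem -/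

/-- The vertices of generation `l` of the infinite `k`-ary tree: words of length `l` over `Fin k`.
The parent of `v : Gen k (l + 1)` is the truncated word `Fin.init v`. -/
abbrev Gen (k l : ℕ) : Type := Fin l → Fin k

/-- `broadcast k π x l σ` is the probability that the broadcast on the `k`-ary tree produces the
configuration `σ` at generation `l`, given that the root colour is `x`. Given the colours up to
generation `l`, those of generation `l + 1` are independent, and a child of a vertex of colour `y`
has colour `z` with probability `π y z`. -/
def broadcast (k : ℕ) {q : ℕ} (π : Matrix (Fin q) (Fin q) ℝ) (x : Fin q) :
    (l : ℕ) → (Gen k l → Fin q) → ℝ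
  | 0, σ => if σ Fin.elim0 = x then 1 else 0
  | l + 1, τ => ∑ σ : Gen k l → Fin q,
      broadcast k π x l σ * ∏ v : Gen k (l + 1), π (σ (Fin.init v)) (τ v)

/-- Mutual information (in bits) of two finite-valued random variables with joint law `p`. -/
def mutualInfo {α β : Type*} [Fintype α] [Fintype β] (p : α → β → ℝ) : ℝ :=
  ∑ a, ∑ b, p a b * Real.logb 2 (p a b / ((∑ b', p a b') * ∑ a', p a' b))

/-- The mutual information between the uniformly random root colour and the configuration
of generation `l`. -/
def rootInfo (k : ℕ) {q : ℕ} (π : Matrix (Fin q) (Fin q) ℝ) (l : ℕ) : ℝ :=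
  mutualInfo fun (x : Fin q) (σ : Gen k l → Fin q) => (1 / (q : ℝ)) * broadcast k π x l σ

/-- Reconstruction is solvable if the information on the root colour carried by generation `l`
has a strictly positive limit as `l → ∞`. -/
def ReconstructionSolvable (k : ℕ) {q : ℕ} (π : Matrix (Fin q) (Fin q) ℝ) : Prop :=
  ∃ I : ℝ, 0 < I ∧ Tendsto (rootInfo k π) atTop (𝓝 I)

/-! ### Distributions over the simplex and their complexity -/

/-- The probability distributions over the alphabet `Fin q`. -/
abbrev Simplex (q : ℕ) : Type := stdSimplex ℝ (Fin q)

/-- A distribution over the simplex is consistent if its expectation is the uniform distribution. -/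
def IsConsistent {q : ℕ} (Q : ProbabilityMeasure (Simplex q)) : Prop :=
  ∀ x : Fin q, ∫ η : Simplex q, (η : Fin q → ℝ) x ∂(Q : Measure (Simplex q)) = 1 / (q : ℝ)

/-- The uniform distribution, as a vector. -/
def unif (q : ℕ) : Fin q → ℝ := fun _ => 1 / (q : ℝ)

/-- `∑_{x₁,x₂} η₁(x₁) η₂(x₂) π(x₁,x₂)`. -/
def edgeSum {q : ℕ} (π : Matrix (Fin q) (Fin q) ℝ) (η₁ η₂ : Fin q → ℝ) : ℝ :=
  ∑ x₁, ∑ x₂, η₁ x₁ * η₂ x₂ * π x₁ x₂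

/-- `∑_x ∏_i ∑_{x_i} η_i(x_i) π(x,x_i)`. -/
def vertexSum {q n : ℕ} (π : Matrix (Fin q) (Fin q) ℝ) (η : Fin n → Fin q → ℝ) : ℝ :=
  ∑ x, ∏ i, ∑ y, η i y * π x y

/-- The edge term `- r log r`, where `r` is `edgeSum` normalised by its value at the uniform
distribution. -/
def edgeTerm {q : ℕ} (π : Matrix (Fin q) (Fin q) ℝ) (η₁ η₂ : Fin q → ℝ) : ℝ :=
  -(edgeSum π η₁ η₂ / edgeSum π (unif q) (unif q)) *
    Real.log (edgeSum π η₁ η₂ / edgeSum π (unif q) (unif q))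

/-- The vertex term `- r log r`, where `r` is `vertexSum` normalised by its value at the uniform
distribution. -/
def vertexTerm {q n : ℕ} (π : Matrix (Fin q) (Fin q) ℝ) (η : Fin n → Fin q → ℝ) : ℝ :=
  -(vertexSum π η / vertexSum π (fun _ : Fin n => unif q)) *
    Real.log (vertexSum π η / vertexSum π (fun _ : Fin n => unif q))

/-- The complexity of a distribution over the simplex, for the `k`-ary tree and the kernel `π`. -/
def complexity (k : ℕ) {q : ℕ} (π : Matrix (Fin q) (Fin q) ℝ)
    (Q : ProbabilityMeasure (Simplex q)) : ℝ :=
  -(((k : ℝ) + 1) / 2) *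
      ∫ p : Simplex q × Simplex q, edgeTerm π p.1 p.2
        ∂((Q : Measure (Simplex q)).prod (Q : Measure (Simplex q)))
    + ∫ η : Fin (k + 1) → Simplex q, vertexTerm π (fun i => (η i : Fin q → ℝ))
        ∂(Measure.pi fun _ : Fin (k + 1) => (Q : Measure (Simplex q)))

end TreeReconstruction

end

/-!
Replace distributions over the simplex by finite channels, recorded as formal nonnegative
combinations of likelihood vectors, `LikAlg q`. In this commutative algebra a product is a pair of
conditionally independent observations, so one step of the tree recursion is
`T Q = (push p Q) ^ k`, and all mutual informations are values of one linear functional `entropy`: the complexity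
becomes `S Q = (k + 1) / 2 * entropy (Q * push p Q) - entropy ((push p Q) ^ (k + 1))`.

The derivative of `S` at `Q` in the direction `D = T Q - Q` is
`-(k + 1) * entropy (D * push p D)`. Frustration makes this quadratic form nonnegative on differences of channels
(`entropy_mul_push_nonneg`): `(1 - s) log (1 - s) + s` has a power series with nonnegative
coefficients, and `s` is a Gram kernel of the positive-definite part of `-p`. Hence an approximate
minimiser of `S` has a small value of the form at `D`, and by Cauchy–Schwarz `T` maps approximate
minimisers to approximate minimisers (`exists_channelComplexity_branch_le`). If `S` takes a
negative value, then so, for every `l` and a bound not depending on `l`, does `S (T^l Q)` for some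
`Q`. But `-S R` is at most `k + 1` times the information that `R` carries on the colour, and by
data processing `T^l Q` carries at most as much as generation `l` of the broadcast, which is `T^l`
of the perfect channel (`iterate_branch_perfect`). So the information, which decreases with `l`,
stays away from zero.

Data processing is expressed by the convex order `LessInformative`, the comparison of the
expectations of sublinear functions of the likelihood. An arbitrary consistent distribution is
reduced to a finite channel by replacing it, on each cell of a fine grid, by the barycentre of the
cell (`exists_channel_of_complexity_neg`); this keeps it exactly consistent and changes the
complexity little, as the integrands are continuous.
-/

open scoped NNReal

noncomputable section

namespace TreeReconstruction

variable {q : ℕ}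

/-! ### Finite channels as elements of a monoid algebra -/

/-- Likelihood vectors: `w x` is the probability of an observation given that the colour is `x`.
They multiply pointwise, as likelihoods of conditionally independent observations do. -/
abbrev Lik (q : ℕ) : Type := Fin q → ℝ≥0

/-- Finite formal real combinations of likelihood vectors. In a channel with input alphabet `Fin q`
and finite output alphabet, a term `c • w` stands for an output with likelihood vector `c * w`; the
factor `c` is free, as only the direction of the likelihood matters to an observer. Products
correspond to observing two conditionally independent outputs. -/
abbrev LikAlg (q : ℕ) : Type := MonoidAlgebra ℝ (Lik q)

/-- The linear extension of a function of likelihood vectors to formal combinations. -/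
def expect (ψ : Lik q → ℝ) : LikAlg q →ₗ[ℝ] ℝ :=
  Finsupp.linearCombination ℝ ψ ∘ₗ (MonoidAlgebra.coeffLinearEquiv ℝ).toLinearMap

lemma expect_apply (ψ : Lik q → ℝ) (Q : LikAlg q) :
    expect ψ Q = ∑ w ∈ Q.coeff.support, Q.coeff w * ψ w := by
  simp [expect, Finsupp.linearCombination_apply, Finsupp.sum]

@[simp] lemma expect_single (ψ : Lik q → ℝ) (w : Lik q) (c : ℝ) :
    expect ψ (MonoidAlgebra.single w c) = c * ψ w := by
  simp [expect]

lemma expect_one (ψ : Lik q → ℝ) : expect ψ 1 = ψ 1 := by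
  simp [MonoidAlgebra.one_def]

lemma expect_add_fun (ψ χ : Lik q → ℝ) (Q : LikAlg q) :
    expect (fun w => ψ w + χ w) Q = expect ψ Q + expect χ Q := by
  simp [expect_apply, mul_add, Finset.sum_add_distrib]

lemma expect_sub_fun (ψ χ : Lik q → ℝ) (Q : LikAlg q) :
    expect (fun w => ψ w - χ w) Q = expect ψ Q - expect χ Q := by
  simp [expect_apply, mul_sub, Finset.sum_sub_distrib]

lemma expect_const_mul (c : ℝ) (ψ : Lik q → ℝ) (Q : LikAlg q) :
    expect (fun w => c * ψ w) Q = c * expect ψ Q := by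
  simp only [expect_apply, Finset.mul_sum]
  exact Finset.sum_congr rfl fun w _ => by ring

lemma expect_mul_const (c : ℝ) (ψ : Lik q → ℝ) (Q : LikAlg q) :
    expect (fun w => ψ w * c) Q = expect ψ Q * c := by
  simp_rw [mul_comm _ c]; exact expect_const_mul c ψ Q

lemma expect_sum_fun {ι : Type*} (s : Finset ι) (ψ : ι → Lik q → ℝ) (Q : LikAlg q) :
    expect (fun w => ∑ i ∈ s, ψ i w) Q = ∑ i ∈ s, expect (ψ i) Q := by
  simp only [expect_apply, Finset.mul_sum]
  exact Finset.sum_comm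

lemma expect_swap (f : Lik q → Lik q → ℝ) (Q R : LikAlg q) :
    expect (fun u => expect (f u) R) Q = expect (fun v => expect (fun u => f u v) Q) R := by
  simp only [expect_apply, Finset.mul_sum]
  rw [Finset.sum_comm]
  exact Finset.sum_congr rfl fun w _ => Finset.sum_congr rfl fun v _ => by ring

lemma expect_mul (ψ : Lik q → ℝ) (Q R : LikAlg q) :
    expect ψ (Q * R) = expect (fun u => expect (fun v => ψ (u * v)) R) Q := by
  induction Q using MonoidAlgebra.induction_linear with
  | zero => simp
  | add Q₁ Q₂ h₁ h₂ => rw [add_mul, map_add, map_add, h₁, h₂]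
  | single u c =>
    induction R using MonoidAlgebra.induction_linear with
    | zero => simp
    | add R₁ R₂ h₁ h₂ =>
      rw [mul_add, map_add, h₁, h₂]
      simp [mul_add]
    | single v d => simp [MonoidAlgebra.single_mul_single, mul_assoc]

/-- The likelihood vector, for the colour of a vertex, of an observation made at one of its
children. -/
def act (p : Matrix (Fin q) (Fin q) ℝ≥0) (w : Lik q) : Lik q := fun x => ∑ y, p x y * w y

/-- The observation of a channel through one additional edge of the tree. -/
def push (p : Matrix (Fin q) (Fin q) ℝ≥0) : LikAlg q →ₗ[ℝ] LikAlg q :=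
  MonoidAlgebra.mapDomainLinearMap ℝ ℝ (act p)

@[simp] lemma push_single (p : Matrix (Fin q) (Fin q) ℝ≥0) (w : Lik q) (c : ℝ) :
    push p (MonoidAlgebra.single w c) = MonoidAlgebra.single (act p w) c := by
  simp [push]

lemma expect_push (p : Matrix (Fin q) (Fin q) ℝ≥0) (ψ : Lik q → ℝ) (Q : LikAlg q) :
    expect ψ (push p Q) = expect (fun w => ψ (act p w)) Q := by
  induction Q using MonoidAlgebra.induction_linear with
  | zero => simp
  | add Q₁ Q₂ h₁ h₂ => rw [map_add, map_add, map_add, h₁, h₂]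
  | single u c => simp

/-- Nonnegativity of a formal combination, stated by duality. -/
def IsPos (Q : LikAlg q) : Prop := ∀ ψ : Lik q → ℝ, (∀ w, 0 ≤ ψ w) → 0 ≤ expect ψ Q

lemma IsPos.expect_mono {Q : LikAlg q} (hQ : IsPos Q) {ψ χ : Lik q → ℝ} (h : ∀ w, ψ w ≤ χ w) :
    expect ψ Q ≤ expect χ Q := by
  have := hQ (fun w => χ w - ψ w) fun w => sub_nonneg.2 (h w)
  rw [expect_sub_fun] at this
  linarith

lemma isPos_single (w : Lik q) {c : ℝ} (hc : 0 ≤ c) : IsPos (MonoidAlgebra.single w c) := by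
  intro ψ hψ
  rw [expect_single]
  exact mul_nonneg hc (hψ w)

lemma IsPos.add {Q R : LikAlg q} (hQ : IsPos Q) (hR : IsPos R) : IsPos (Q + R) := by
  intro ψ hψ
  rw [map_add]
  exact add_nonneg (hQ ψ hψ) (hR ψ hψ)

lemma IsPos.smul {Q : LikAlg q} (hQ : IsPos Q) {c : ℝ} (hc : 0 ≤ c) : IsPos (c • Q) := by
  intro ψ hψ
  rw [map_smul]
  exact mul_nonneg hc (hQ ψ hψ)

lemma isPos_sum {ι : Type*} (s : Finset ι) (Q : ι → LikAlg q) (h : ∀ i ∈ s, IsPos (Q i)) :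
    IsPos (∑ i ∈ s, Q i) := by
  intro ψ hψ
  rw [map_sum]
  exact Finset.sum_nonneg fun i hi => h i hi ψ hψ

lemma IsPos.mul {Q R : LikAlg q} (hQ : IsPos Q) (hR : IsPos R) : IsPos (Q * R) := by
  intro ψ hψ
  rw [expect_mul]
  exact hQ _ fun u => hR _ fun v => hψ _

lemma IsPos.push {Q : LikAlg q} (hQ : IsPos Q) (p : Matrix (Fin q) (Fin q) ℝ≥0) :
    IsPos (push p Q) := by
  intro ψ hψ
  rw [expect_push]
  exact hQ _ fun w => hψ _

/-- The total probability of the outputs given the input colour `x`. -/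
def total (x : Fin q) : LikAlg q →ₗ[ℝ] ℝ := expect fun w => (w x : ℝ)

/-- A finite channel: nonnegative weights and, for each input colour, total probability one. -/
structure IsChannel (Q : LikAlg q) : Prop where
  pos : IsPos Q
  total_eq : ∀ x, total x Q = 1

lemma total_mul (x : Fin q) (Q R : LikAlg q) : total x (Q * R) = total x Q * total x R := by
  rw [total, expect_mul]
  simp only [Pi.mul_apply, NNReal.coe_mul, expect_const_mul, expect_mul_const]

lemma total_push (p : Matrix (Fin q) (Fin q) ℝ≥0) (x : Fin q) (Q : LikAlg q) :
    total x (push p Q) = ∑ y, (p x y : ℝ) * total y Q := by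
  rw [total, expect_push]
  simp only [act, NNReal.coe_sum, NNReal.coe_mul, expect_sum_fun, expect_const_mul]
  rfl

lemma isChannel_one : IsChannel (1 : LikAlg q) where
  pos := isPos_single 1 zero_le_one
  total_eq x := by simp [total, expect_one]

lemma IsChannel.mul {Q R : LikAlg q} (hQ : IsChannel Q) (hR : IsChannel R) :
    IsChannel (Q * R) where
  pos := hQ.pos.mul hR.pos
  total_eq x := by rw [total_mul, hQ.total_eq, hR.total_eq, one_mul]

lemma IsChannel.pow {Q : LikAlg q} (hQ : IsChannel Q) (n : ℕ) : IsChannel (Q ^ n) := by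
  induction n with
  | zero => rw [pow_zero]; exact isChannel_one
  | succ n ih => rw [pow_succ]; exact ih.mul hQ

lemma IsChannel.mix {Q R : LikAlg q} (hQ : IsChannel Q) (hR : IsChannel R) {h : ℝ}
    (h0 : 0 ≤ h) (h1 : h ≤ 1) : IsChannel (Q + h • (R - Q)) where
  pos := by
    have : Q + h • (R - Q) = (1 - h) • Q + h • R := by module
    rw [this]
    exact (hQ.pos.smul (by linarith)).add (hR.pos.smul h0)
  total_eq x := by simp [hQ.total_eq, hR.total_eq]

/-- The real matrix underlying a matrix with entries in `ℝ≥0`. -/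
def realMatrix (p : Matrix (Fin q) (Fin q) ℝ≥0) : Matrix (Fin q) (Fin q) ℝ := fun x y => p x y

/-- Symmetric stochastic matrices, with entries in `ℝ≥0`. -/
structure IsSymmStochastic (p : Matrix (Fin q) (Fin q) ℝ≥0) : Prop where
  sum_eq : ∀ x, ∑ y, (p x y : ℝ) = 1
  symm : ∀ x y, p x y = p y x

lemma IsChannel.push {Q : LikAlg q} (hQ : IsChannel Q) {p : Matrix (Fin q) (Fin q) ℝ≥0}
    (hp : IsSymmStochastic p) : IsChannel (push p Q) where
  pos := hQ.pos.push p
  total_eq x := by simp [total_push, hQ.total_eq, hp.sum_eq]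

/-- The channel that reveals the colour. -/
def perfect (q : ℕ) : LikAlg q := ∑ x : Fin q, MonoidAlgebra.single (Pi.single x 1) 1

lemma expect_perfect (ψ : Lik q → ℝ) : expect ψ (perfect q) = ∑ x, ψ (Pi.single x 1) := by
  simp [perfect]

lemma isChannel_perfect : IsChannel (perfect q) where
  pos := isPos_sum _ _ fun x _ => isPos_single _ zero_le_one
  total_eq x := by
    rw [total, expect_perfect, Finset.sum_eq_single x]
    · simp
    · intro y _ hy; simp [hy.symm]
    · simp

/-! ### The convex order on channels -/

/-- Sublinear functions of a likelihood vector. -/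
structure Sublinear (ψ : Lik q → ℝ) : Prop where
  add_le : ∀ u v, ψ (u + v) ≤ ψ u + ψ v
  smul_eq : ∀ (c : ℝ≥0) (u : Lik q), ψ (c • u) = c * ψ u

lemma Sublinear.zero {ψ : Lik q → ℝ} (h : Sublinear ψ) : ψ 0 = 0 := by
  simpa using h.smul_eq 0 0

lemma Sublinear.sum_le {ψ : Lik q → ℝ} (h : Sublinear ψ) {ι : Type*} (s : Finset ι)
    (c : ι → ℝ≥0) (u : ι → Lik q) : ψ (∑ i ∈ s, c i • u i) ≤ ∑ i ∈ s, (c i : ℝ) * ψ (u i) := by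
  classical
  induction s using Finset.induction_on with
  | empty => simp [h.zero]
  | insert a s ha ih =>
    rw [Finset.sum_insert ha, Finset.sum_insert ha]
    refine (h.add_le _ _).trans ?_
    rw [h.smul_eq]
    linarith

/-- `Q` is less informative than `R`: every sublinear function has a smaller expectation. -/
def LessInformative (Q R : LikAlg q) : Prop :=
  ∀ ψ : Lik q → ℝ, Sublinear ψ → expect ψ Q ≤ expect ψ R

lemma LessInformative.trans {Q R S : LikAlg q} (h : LessInformative Q R)
    (h' : LessInformative R S) : LessInformative Q S :=
  fun ψ hψ => (h ψ hψ).trans (h' ψ hψ)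

lemma LessInformative.mul_left {Q R U : LikAlg q} (h : LessInformative Q R) (hU : IsPos U) :
    LessInformative (U * Q) (U * R) := by
  intro ψ hψ
  rw [expect_mul, expect_mul]
  refine hU.expect_mono fun u => h _ ⟨fun v w => ?_, fun c v => ?_⟩
  · rw [mul_add]; exact hψ.add_le _ _
  · rw [mul_smul_comm]; exact hψ.smul_eq _ _

lemma LessInformative.pow {Q R : LikAlg q} (h : LessInformative Q R) (hQ : IsChannel Q)
    (hR : IsChannel R) (n : ℕ) : LessInformative (Q ^ n) (R ^ n) := by
  induction n with
  | zero => intro ψ _; simp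
  | succ n ih =>
    have h1 := h.mul_left (hQ.pow n).pos
    have h2 := ih.mul_left hR.pos
    rw [mul_comm R, mul_comm R] at h2
    rw [pow_succ, pow_succ]
    exact h1.trans h2

lemma act_add (p : Matrix (Fin q) (Fin q) ℝ≥0) (u v : Lik q) :
    act p (u + v) = act p u + act p v := by
  ext x; simp [act, mul_add, Finset.sum_add_distrib]

lemma act_smul (p : Matrix (Fin q) (Fin q) ℝ≥0) (c : ℝ≥0) (u : Lik q) :
    act p (c • u) = c • act p u := by
  ext x
  simp only [act, Pi.smul_apply, smul_eq_mul, Finset.mul_sum]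
  congr 1
  exact Finset.sum_congr rfl fun y _ => by ring

lemma LessInformative.push {Q R : LikAlg q} (h : LessInformative Q R)
    (p : Matrix (Fin q) (Fin q) ℝ≥0) : LessInformative (push p Q) (push p R) := by
  intro ψ hψ
  rw [expect_push, expect_push]
  refine h _ ⟨fun v w => ?_, fun c v => ?_⟩
  · rw [act_add]; exact hψ.add_le _ _
  · rw [act_smul]; exact hψ.smul_eq _ _

lemma IsChannel.coeff_nonneg {Q : LikAlg q} (hQ : IsChannel Q) (w : Lik q) : 0 ≤ Q.coeff w := by
  classical
  have := hQ.pos (fun v => if v = w then 1 else 0) fun v => by positivity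
  rw [expect_apply] at this
  simp only [mul_ite, mul_one, mul_zero, Finset.sum_ite_eq', Finsupp.mem_support_iff] at this
  split_ifs at this with h
  · exact this
  · simp only [ne_eq, not_not] at h; exact h.ge

/-- Jensen's inequality: the channel without information lies below every channel. -/
lemma IsChannel.one_lessInformative {Q : LikAlg q} (hQ : IsChannel Q) : LessInformative 1 Q := by
  intro ψ hψ
  have h1 : (1 : Lik q) = ∑ w ∈ Q.coeff.support, (Q.coeff w).toNNReal • w := by
    ext x
    have := hQ.total_eq x
    rw [total, expect_apply] at this
    rw [Finset.sum_apply, NNReal.coe_sum, Pi.one_apply, NNReal.coe_one, ← this]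
    exact Finset.sum_congr rfl fun w _ => by simp [hQ.coeff_nonneg w]
  rw [expect_one, h1, expect_apply]
  refine (hψ.sum_le _ _ _).trans (Finset.sum_le_sum fun w _ => ?_)
  rw [Real.coe_toNNReal _ (hQ.coeff_nonneg w)]

lemma IsChannel.lessInformative_perfect {Q : LikAlg q} (hQ : IsChannel Q) :
    LessInformative Q (perfect q) := by
  intro ψ hψ
  have h : ∀ w : Lik q, ψ w ≤ ∑ x, (w x : ℝ) * ψ (Pi.single x 1) := by
    intro w
    have := hψ.sum_le Finset.univ w fun x => Pi.single x 1
    convert this using 2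
    ext x
    simp [Finset.sum_apply, Pi.single_apply]
  refine (hQ.pos.expect_mono h).trans_eq ?_
  rw [expect_perfect, expect_sum_fun]
  refine Finset.sum_congr rfl fun x _ => ?_
  rw [expect_mul_const]
  have := hQ.total_eq x
  rw [total] at this
  rw [this, one_mul]

/-! ### The entropy functional -/

/-- The probability of an observation when the colour is uniform. -/
def prob (w : Lik q) : ℝ := (∑ x, (w x : ℝ)) / q

/-- The function `t log t` of the probability of an observation. -/
def ent (w : Lik q) : ℝ := prob w * Real.log (prob w)

/-- The linear extension of `ent`: minus the output entropy under the uniform input, for a channel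
all of whose terms have coefficient one. Splitting a coefficient off a likelihood vector changes it
by amounts that cancel in mutual informations: the one between the outputs of conditionally
independent channels `Q` and `R` is `entropy (Q * R) - entropy Q - entropy R`. -/
def entropy : LikAlg q →ₗ[ℝ] ℝ := expect ent

lemma prob_nonneg (w : Lik q) : 0 ≤ prob w := by unfold prob; positivity

lemma prob_add (u v : Lik q) : prob (u + v) = prob u + prob v := by
  simp [prob, Finset.sum_add_distrib, add_div]

lemma prob_smul (c : ℝ≥0) (u : Lik q) : prob (c • u) = c * prob u := by
  simp [prob, ← Finset.mul_sum, mul_div_assoc]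

lemma prob_mul_eq_zero [NeZero q] {v w : Lik q} (h : prob w = 0) : prob (v * w) = 0 := by
  have hq : (q : ℝ) ≠ 0 := NeZero.ne _
  have h0 : ∑ x, (w x : ℝ) = 0 := by simpa [prob, hq] using h
  rw [Finset.sum_eq_zero_iff_of_nonneg fun x _ => NNReal.coe_nonneg _] at h0
  have : ∀ x, (w x : ℝ) = 0 := fun x => h0 x (Finset.mem_univ x)
  simp [prob, this]

lemma prob_one [NeZero q] : prob (1 : Lik q) = 1 := by
  have hq : (q : ℝ) ≠ 0 := NeZero.ne _
  simp [prob, hq]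

lemma prob_single [NeZero q] (x : Fin q) : prob (Pi.single x 1) = 1 / q := by
  unfold prob
  rw [Finset.sum_eq_single x]
  · simp
  · intro y _ hy; simp [hy]
  · simp

lemma entropy_one [NeZero q] : entropy (1 : LikAlg q) = 0 := by
  simp [entropy, expect_one, ent, prob_one]

lemma prob_mul_act {p : Matrix (Fin q) (Fin q) ℝ≥0} (hp : IsSymmStochastic p) (u v : Lik q) :
    prob (u * act p v) = prob (act p u * v) := by
  unfold prob
  congr 1
  simp only [act, Pi.mul_apply, NNReal.coe_mul, NNReal.coe_sum, Finset.mul_sum, Finset.sum_mul]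
  rw [Finset.sum_comm]
  refine Finset.sum_congr rfl fun x _ => Finset.sum_congr rfl fun y _ => ?_
  rw [hp.symm y x]
  ring

lemma act_one {p : Matrix (Fin q) (Fin q) ℝ≥0} (hp : IsSymmStochastic p) : act p 1 = 1 := by
  ext x
  simp [act, hp.sum_eq]

lemma prob_act {p : Matrix (Fin q) (Fin q) ℝ≥0} (hp : IsSymmStochastic p) (u : Lik q) :
    prob (act p u) = prob u := by
  have := prob_mul_act hp u 1
  rw [act_one hp, mul_one, mul_one] at this
  exact this.symm

lemma entropy_push {p : Matrix (Fin q) (Fin q) ℝ≥0} (hp : IsSymmStochastic p) (Q : LikAlg q) :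
    entropy (push p Q) = entropy Q := by
  simp only [entropy, expect_push, ent, prob_act hp]
  rfl

lemma entropy_mul_push_comm {p : Matrix (Fin q) (Fin q) ℝ≥0} (hp : IsSymmStochastic p)
    (Q R : LikAlg q) : entropy (Q * push p R) = entropy (push p Q * R) := by
  simp only [entropy, expect_mul, expect_push, ent, prob_mul_act hp]

lemma entropy_mul_push_symm {p : Matrix (Fin q) (Fin q) ℝ≥0} (hp : IsSymmStochastic p)
    (Q R : LikAlg q) : entropy (Q * push p R) = entropy (R * push p Q) := by
  rw [entropy_mul_push_comm hp, mul_comm]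

lemma IsChannel.expect_prob_mul {U : LikAlg q} (hU : IsChannel U) (w : Lik q) :
    expect (fun v => prob (w * v)) U = prob w := by
  have h : (fun v : Lik q => prob (w * v)) = fun v => ∑ x, ((w x : ℝ) / q) * (v x : ℝ) := by
    ext v
    simp only [prob, Pi.mul_apply, NNReal.coe_mul, Finset.sum_div]
    exact Finset.sum_congr rfl fun x _ => by ring
  have ht := hU.total_eq
  simp only [total] at ht
  rw [h, expect_sum_fun]
  simp only [expect_const_mul, ht, mul_one, prob, Finset.sum_div]

/-- The pointwise mutual information between outputs `v` and `w` of two channels, weighted with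
their joint probability. -/
def infoKernel (v w : Lik q) : ℝ :=
  ent (w * v) - prob (w * v) * Real.log (prob w) - prob (w * v) * Real.log (prob v)

/-- The mutual information between two conditionally independent outputs, in terms of `entropy`. -/
lemma entropy_mul {Q U : LikAlg q} (hQ : IsChannel Q) (hU : IsChannel U) :
    entropy (Q * U) =
      entropy Q + entropy U + expect (fun v => expect (infoKernel v) Q) U := by
  have e1 : expect (fun v => expect (infoKernel v) Q) U =
      expect (fun v => expect (fun w => ent (w * v)) Q) U
      - expect (fun v => expect (fun w => prob (w * v) * Real.log (prob w)) Q) U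
      - expect (fun v => expect (fun w => prob (w * v) * Real.log (prob v)) Q) U := by
    rw [← expect_sub_fun, ← expect_sub_fun]
    congr 2
    funext v
    rw [← expect_sub_fun, ← expect_sub_fun]
    rfl
  have e2 : expect (fun v => expect (fun w => prob (w * v) * Real.log (prob w)) Q) U
      = entropy Q := by
    rw [← expect_swap (fun w v => prob (w * v) * Real.log (prob w))]
    simp only [expect_mul_const, hU.expect_prob_mul]
    rfl
  have e3 : expect (fun v => expect (fun w => prob (w * v) * Real.log (prob v)) Q) U
      = entropy U := by
    simp only [expect_mul_const, mul_comm _ (_ : Lik q), hQ.expect_prob_mul]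
    rfl
  have e4 : expect (fun v => expect (fun w => ent (w * v)) Q) U = entropy (Q * U) := by
    rw [← expect_swap (fun w v => ent (w * v)), entropy, expect_mul]
  rw [e1, e2, e3, e4]
  ring

/-- One term of the log-sum inequality: the tangent-line bound at the ratio `G / N`. -/
lemma mul_log_sub_log_ge {g n G N : ℝ} (hg : 0 ≤ g) (hn : 0 ≤ n) (h0 : n = 0 → g = 0)
    (hG : 0 ≤ G) (hN : 0 < N) (hG0 : 0 < g → 0 < G) :
    g * (Real.log G - Real.log N) + (g - n * G / N) ≤ g * (Real.log g - Real.log n) := by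
  rcases hg.eq_or_lt with rfl | hg
  · have : 0 ≤ n * G / N := by positivity
    simp only [zero_mul, zero_sub, zero_add]
    linarith
  · have hn' : 0 < n := lt_of_le_of_ne hn fun h => hg.ne' (h0 h.symm)
    have hG' := hG0 hg
    have key := Real.one_sub_inv_le_log_of_pos (show 0 < (g / n) / (G / N) by positivity)
    rw [Real.log_div (by positivity) (by positivity), Real.log_div hg.ne' hn'.ne',
      Real.log_div hG'.ne' hN.ne'] at key
    have key2 := mul_le_mul_of_nonneg_left key hg.le
    have : g * (1 - ((g / n) / (G / N))⁻¹) = g - n * G / N := by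
      field_simp
    rw [this] at key2
    linarith

lemma log_sum_inequality {g₁ g₂ n₁ n₂ : ℝ} (hg₁ : 0 ≤ g₁) (hg₂ : 0 ≤ g₂) (hn₁ : 0 ≤ n₁)
    (hn₂ : 0 ≤ n₂) (h₁ : n₁ = 0 → g₁ = 0) (h₂ : n₂ = 0 → g₂ = 0) :
    (g₁ + g₂) * (Real.log (g₁ + g₂) - Real.log (n₁ + n₂)) ≤
      g₁ * (Real.log g₁ - Real.log n₁) + g₂ * (Real.log g₂ - Real.log n₂) := by
  rcases (add_nonneg hn₁ hn₂).eq_or_lt with h | h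
  · have a₁ : n₁ = 0 := by linarith
    have a₂ : n₂ = 0 := by linarith
    simp [h₁ a₁, h₂ a₂]
  · have k₁ := mul_log_sub_log_ge hg₁ hn₁ h₁ (add_nonneg hg₁ hg₂) h (fun h => by linarith)
    have k₂ := mul_log_sub_log_ge hg₂ hn₂ h₂ (add_nonneg hg₁ hg₂) h (fun h => by linarith)
    have : n₁ * (g₁ + g₂) / (n₁ + n₂) + n₂ * (g₁ + g₂) / (n₁ + n₂) = g₁ + g₂ := by
      field_simp
    linarith

lemma sublinear_infoKernel [NeZero q] (v : Lik q) : Sublinear (infoKernel v) where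
  add_le w₁ w₂ := by
    have h := log_sum_inequality (prob_nonneg (w₁ * v)) (prob_nonneg (w₂ * v)) (prob_nonneg w₁)
      (prob_nonneg w₂) (fun h => by rw [mul_comm]; exact prob_mul_eq_zero h)
      (fun h => by rw [mul_comm]; exact prob_mul_eq_zero h)
    simp only [infoKernel, ent, add_mul w₁ w₂ v, prob_add]
    linarith
  smul_eq c w := by
    simp only [infoKernel, ent, smul_mul_assoc, prob_smul]
    rcases eq_or_ne c 0 with rfl | hc
    · simp
    have hc' : (c : ℝ) ≠ 0 := by exact_mod_cast hc
    rcases eq_or_ne (prob (w * v)) 0 with h | h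
    · simp [h]
    have hw : prob w ≠ 0 := fun h' => h (by rw [mul_comm]; exact prob_mul_eq_zero h')
    rw [Real.log_mul hc' h, Real.log_mul hc' hw]
    ring

/-- The data processing inequality. -/
lemma LessInformative.entropy_mul_sub_le [NeZero q] {Q R U : LikAlg q} (h : LessInformative Q R)
    (hQ : IsChannel Q) (hR : IsChannel R) (hU : IsChannel U) :
    entropy (Q * U) - entropy Q ≤ entropy (R * U) - entropy R := by
  rw [entropy_mul hQ hU, entropy_mul hR hU]
  have := hU.pos.expect_mono fun v => h _ (sublinear_infoKernel v)
  linarith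

lemma IsChannel.entropy_add_le [NeZero q] {Q U : LikAlg q} (hQ : IsChannel Q) (hU : IsChannel U) :
    entropy Q + entropy U ≤ entropy (Q * U) := by
  have := hQ.one_lessInformative.entropy_mul_sub_le isChannel_one hQ hU
  rw [one_mul, entropy_one] at this
  linarith

/-- The mutual information between the colour and the output of a channel. -/
def rootMutualInfo : LikAlg q →ₗ[ℝ] ℝ :=
  expect fun w => ∑ x : Fin q, infoKernel (Pi.single x 1) w

lemma entropy_mul_perfect {Q : LikAlg q} (hQ : IsChannel Q) :
    entropy (Q * perfect q) = entropy Q + entropy (perfect q) + rootMutualInfo Q := by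
  rw [entropy_mul hQ isChannel_perfect, expect_perfect, ← expect_sum_fun]
  rfl

lemma IsChannel.entropy_mul_le_rootMutualInfo [NeZero q] {Q U : LikAlg q} (hQ : IsChannel Q)
    (hU : IsChannel U) : entropy (Q * U) ≤ entropy Q + entropy U + rootMutualInfo U := by
  have h1 := hQ.lessInformative_perfect.entropy_mul_sub_le hQ isChannel_perfect hU
  rw [mul_comm (perfect q), entropy_mul_perfect hU] at h1
  linarith

lemma sublinear_rootMutualInfo [NeZero q] :
    Sublinear fun w : Lik q => ∑ x : Fin q, infoKernel (Pi.single x 1) w where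
  add_le u v := by
    rw [← Finset.sum_add_distrib]
    exact Finset.sum_le_sum fun x _ => (sublinear_infoKernel _).add_le u v
  smul_eq c u := by
    rw [Finset.mul_sum]
    exact Finset.sum_congr rfl fun x _ => (sublinear_infoKernel _).smul_eq c u

lemma LessInformative.rootMutualInfo_le [NeZero q] {Q R : LikAlg q} (h : LessInformative Q R) :
    rootMutualInfo Q ≤ rootMutualInfo R := h _ sublinear_rootMutualInfo

lemma entropy_perfect [NeZero q] : entropy (perfect q) = - Real.log q := by
  have hq : (q : ℝ) ≠ 0 := NeZero.ne _
  simp only [entropy, expect_perfect, ent, prob_single]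
  simp
  field_simp

lemma perfect_mul_perfect_entropy [NeZero q] :
    entropy (perfect q * perfect q) = entropy (perfect q) := by
  simp only [entropy, expect_mul, expect_perfect]
  refine Finset.sum_congr rfl fun x _ => ?_
  rw [Finset.sum_eq_single x]
  · rw [← Pi.single_mul, one_mul]
  · intro y _ hy
    have : (Pi.single x 1 * Pi.single y 1 : Lik q) = 0 := by
      ext z
      by_cases hz : z = x
      · subst hz; simp [hy.symm]
      · simp [hz]
    rw [this]
    simp [ent, prob]
  · simp

lemma rootMutualInfo_perfect [NeZero q] : rootMutualInfo (perfect q) = Real.log q := by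
  have := entropy_mul_perfect (isChannel_perfect (q := q))
  rw [perfect_mul_perfect_entropy, entropy_perfect] at this
  linarith

lemma IsChannel.entropy_mul_le [NeZero q] {Q U : LikAlg q} (hQ : IsChannel Q) (hU : IsChannel U) :
    entropy (Q * U) ≤ entropy Q + entropy U + Real.log q := by
  have h1 := hQ.entropy_mul_le_rootMutualInfo hU
  have h2 := hU.lessInformative_perfect.rootMutualInfo_le
  rw [rootMutualInfo_perfect] at h2
  linarith

/-! ### Positivity of the edge information for a frustrated kernel -/

lemma expect_hasSum {f : ℕ → Lik q → ℝ} {g : Lik q → ℝ} (h : ∀ w, HasSum (fun n => f n w) (g w))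
    (Q : LikAlg q) : HasSum (fun n => expect (f n) Q) (expect g Q) := by
  simp only [expect_apply]
  exact hasSum_sum fun w _ => (h w).mul_left _

lemma expect_tendsto {ι : Type*} {l : Filter ι} {f : ι → Lik q → ℝ} {g : Lik q → ℝ}
    (h : ∀ w, Tendsto (fun n => f n w) l (𝓝 (g w))) (Q : LikAlg q) :
    Tendsto (fun n => expect (f n) Q) l (𝓝 (expect g Q)) := by
  simp only [expect_apply]
  exact tendsto_finsetSum _ fun w _ => (h w).const_mul _

/-- Powers of a Gram kernel are positive semidefinite. -/
lemma expect_gram_pow_nonneg {ι : Type*} [Fintype ι] (b : ι → Lik q → ℝ) (N : Lik q → ℝ) (m : ℕ)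
    (Q : LikAlg q) :
    0 ≤ expect (fun u => expect (fun v => N u * N v * (∑ i, b i u * b i v) ^ m) Q) Q := by
  classical
  have h : ∀ u v, N u * N v * (∑ i, b i u * b i v) ^ m =
      ∑ f : Fin m → ι, (N u * ∏ j, b (f j) u) * (N v * ∏ j, b (f j) v) := by
    intro u v
    rw [← Fin.prod_const, Finset.prod_univ_sum, Finset.mul_sum]
    simp only [Fintype.piFinset_univ, Finset.prod_mul_distrib]
    exact Finset.sum_congr rfl fun f _ => by ring
  simp only [h, expect_sum_fun, expect_const_mul, expect_mul_const]
  exact Finset.sum_nonneg fun f _ => mul_self_nonneg _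

/-- The power series of `(1 - s) log (1 - s) + s` has nonnegative coefficients and no terms of
order less than two. -/
lemma hasSum_one_sub_mul_log {s : ℝ} (hs : |s| < 1) :
    HasSum (fun n : ℕ => (1 / ((n : ℝ) + 1) - 1 / ((n : ℝ) + 2)) * s ^ (n + 2))
      ((1 - s) * Real.log (1 - s) + s) := by
  have h := Real.hasSum_pow_div_log_of_abs_lt_one hs
  have h1 := (hasSum_nat_add_iff' 1).2 h
  have h2 := (h.mul_left s).sub h1
  convert! h2 using 1
  · funext n
    push_cast
    field_simp
    ring
  · simp only [Finset.range_one, Finset.sum_singleton, zero_add, pow_one, Nat.cast_zero, div_one]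
    ring

/-- Positive semidefiniteness of `(1 - s) log (1 - s) + s` for a Gram kernel `s` bounded by one. -/
lemma expect_one_sub_mul_log_nonneg {ι : Type*} [Fintype ι] (b : ι → Lik q → ℝ) (N : Lik q → ℝ)
    {κ : ℝ} (hκ : 0 ≤ κ) (h1 : ∀ u v, |κ * ∑ i, b i u * b i v| ≤ 1) (Q : LikAlg q) :
    0 ≤ expect (fun u => expect (fun v => N u * N v *
      ((1 - κ * ∑ i, b i u * b i v) * Real.log (1 - κ * ∑ i, b i u * b i v) +
        κ * ∑ i, b i u * b i v)) Q) Q := by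
  -- The series is used at `t * s` with `t < 1`, since `s = 1` may occur.
  have key : ∀ t ∈ Set.Ioo (0 : ℝ) 1, 0 ≤ expect (fun u => expect (fun v => N u * N v *
      ((1 - t * (κ * ∑ i, b i u * b i v)) * Real.log (1 - t * (κ * ∑ i, b i u * b i v)) +
        t * (κ * ∑ i, b i u * b i v))) Q) Q := by
    rintro t ⟨ht0, ht1⟩
    have hlt : ∀ u v, |t * (κ * ∑ i, b i u * b i v)| < 1 := by
      intro u v
      rw [abs_mul, abs_of_pos ht0]
      nlinarith [h1 u v, abs_nonneg (κ * ∑ i, b i u * b i v)]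
    have hs := expect_hasSum (fun u => expect_hasSum (fun v =>
      (hasSum_one_sub_mul_log (hlt u v)).mul_left (N u * N v)) Q) Q
    refine hs.nonneg fun n => ?_
    have hc : (0 : ℝ) ≤ 1 / ((n : ℝ) + 1) - 1 / ((n : ℝ) + 2) := by
      rw [sub_nonneg]
      exact one_div_le_one_div_of_le (by positivity) (by linarith)
    have he : ∀ u v, N u * N v * ((1 / ((n : ℝ) + 1) - 1 / ((n : ℝ) + 2)) *
        (t * (κ * ∑ i, b i u * b i v)) ^ (n + 2)) =
        ((1 / ((n : ℝ) + 1) - 1 / ((n : ℝ) + 2)) * (t * κ) ^ (n + 2)) *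
          (N u * N v * (∑ i, b i u * b i v) ^ (n + 2)) := by
      intro u v
      rw [← mul_assoc t κ, mul_pow (t * κ)]
      ring
    simp only [he, expect_const_mul]
    exact mul_nonneg (mul_nonneg hc (by positivity)) (expect_gram_pow_nonneg b N _ Q)
  have hlim : Tendsto (fun t : ℝ => expect (fun u => expect (fun v => N u * N v *
      ((1 - t * (κ * ∑ i, b i u * b i v)) * Real.log (1 - t * (κ * ∑ i, b i u * b i v)) +
        t * (κ * ∑ i, b i u * b i v))) Q) Q) (𝓝[<] 1) (𝓝 (expect (fun u => expect (fun v =>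
      N u * N v * ((1 - κ * ∑ i, b i u * b i v) * Real.log (1 - κ * ∑ i, b i u * b i v) +
        κ * ∑ i, b i u * b i v)) Q) Q)) := by
    refine expect_tendsto (fun u => expect_tendsto (fun v => ?_) Q) Q
    have hcont : Continuous fun t : ℝ => N u * N v *
      ((1 - t * (κ * ∑ i, b i u * b i v)) * Real.log (1 - t * (κ * ∑ i, b i u * b i v)) +
        t * (κ * ∑ i, b i u * b i v)) := by
      have := Real.continuous_mul_log.comp
        (show Continuous fun t : ℝ => 1 - t * (κ * ∑ i, b i u * b i v) by fun_prop)
      exact continuous_const.mul (this.add (by fun_prop))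
    have := (hcont.tendsto 1).mono_left (nhdsWithin_le_nhds (s := Set.Iio 1))
    simpa only [one_mul] using this
  exact ge_of_tendsto hlim (by
    filter_upwards [Ioo_mem_nhdsLT (show (0 : ℝ) < 1 by norm_num)] with t ht using key t ht)

lemma expect_linear_eq_zero {Q : LikAlg q} (hQ : ∀ x, total x Q = 0) (a : Fin q → ℝ) :
    expect (fun v => ∑ x, a x * (v x : ℝ)) Q = 0 := by
  simp only [total] at hQ
  simp [expect_sum_fun, expect_const_mul, hQ]

/-- The second variation of the edge information: for a frustrated kernel the quadratic form
`entropy (Q * push p Q)` is nonnegative on differences of channels. -/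
lemma entropy_mul_push_nonneg [NeZero q] {p : Matrix (Fin q) (Fin q) ℝ≥0}
    (hp : IsSymmStochastic p) (hfr : IsFrustrated (realMatrix p)) {Q : LikAlg q}
    (hQ : ∀ x, total x Q = 0) : 0 ≤ entropy (Q * push p Q) := by
  obtain ⟨c, A, hA, hpA⟩ := hfr
  simp only [realMatrix] at hpA
  open scoped MatrixOrder in
  obtain ⟨B, hB⟩ := CStarAlgebra.nonneg_iff_eq_star_mul_self.1 hA.posSemidef.nonneg
  have hq : (0 : ℝ) < q := Nat.cast_pos.2 (NeZero.pos q)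
  -- `B w` and its Gram matrix, the quadratic form of `A`
  set β : Fin q → Lik q → ℝ := fun i w => ∑ x, B i x * (w x : ℝ) with hβ
  have hAB : ∀ x y, A x y = ∑ i, B i x * B i y := by
    intro x y
    rw [hB, Matrix.star_eq_conjTranspose, Matrix.mul_apply]
    simp [Matrix.conjTranspose_apply]
  have hsum : ∀ u v : Lik q, ∑ x, ∑ y, (u x : ℝ) * A x y * (v y : ℝ) = ∑ i, β i u * β i v := by
    intro u v
    have e : ∀ i, β i u * β i v = ∑ x, ∑ y, (B i x * (u x : ℝ)) * (B i y * (v y : ℝ)) :=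
      fun i => Finset.sum_mul_sum ..
    simp only [e]
    symm
    rw [Finset.sum_comm]
    refine Finset.sum_congr rfl fun x _ => ?_
    rw [Finset.sum_comm]
    refine Finset.sum_congr rfl fun y _ => ?_
    rw [hAB x y, Finset.mul_sum, Finset.sum_mul]
    exact Finset.sum_congr rfl fun i _ => by ring
  have hprob : ∀ u v : Lik q, prob (u * act p v) =
      c * q * (prob u * prob v) - (∑ i, β i u * β i v) / q := by
    intro u v
    rw [← hsum]
    have : (∑ x, (u x : ℝ)) * ∑ y, (v y : ℝ) = ∑ x, ∑ y, (u x : ℝ) * v y := Finset.sum_mul_sum ..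
    have e : c * q * (prob u * prob v) = (c * ((∑ x, (u x : ℝ)) * ∑ y, (v y : ℝ))) / q := by
      unfold prob; field_simp
    rw [e, this, ← sub_div, prob]
    congr 1
    simp only [Pi.mul_apply, act, NNReal.coe_mul, NNReal.coe_sum, hpA, Finset.mul_sum,
      ← Finset.sum_sub_distrib]
    exact Finset.sum_congr rfl fun x _ => Finset.sum_congr rfl fun y _ => by ring
  -- positivity of the constant
  have hc : 0 < c * q := by
    have h := hprob 1 1
    rw [act_one hp, mul_one, prob_one] at h
    have : 0 ≤ (∑ i, β i 1 * β i 1) / (q : ℝ) :=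
      div_nonneg (Finset.sum_nonneg fun i _ => mul_self_nonneg _) hq.le
    linarith
  have hc0 : c ≠ 0 := fun h => by simp [h] at hc
  set b : Fin q → Lik q → ℝ := fun i w => β i w / prob w with hb
  set κ : ℝ := 1 / (c * q * q) with hκ
  have hκ0 : 0 < κ := by positivity
  have hβ0 : ∀ i w, prob w = 0 → β i w = 0 := by
    intro i w hw
    have h0 : ∑ x, (w x : ℝ) = 0 := by simpa [prob, hq.ne'] using hw
    rw [Finset.sum_eq_zero_iff_of_nonneg fun x _ => NNReal.coe_nonneg _] at h0
    exact Finset.sum_eq_zero fun x hx => by rw [h0 x hx, mul_zero]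
  have hNb : ∀ i w, prob w * b i w = β i w := by
    intro i w
    rcases eq_or_ne (prob w) 0 with h | h
    · rw [h, zero_mul, hβ0 i w h]
    · simp only [hb]; field_simp
  have hNs : ∀ u v, prob u * prob v * (κ * ∑ i, b i u * b i v) =
      κ * ∑ i, β i u * β i v := by
    intro u v
    simp only [← hNb, Finset.mul_sum]
    exact Finset.sum_congr rfl fun i _ => by ring
  have hprob' : ∀ u v, prob (u * act p v) =
      c * q * (prob u * prob v) * (1 - κ * ∑ i, b i u * b i v) := by
    intro u v
    rw [mul_sub, mul_assoc (c * q) (prob u * prob v) (κ * _), hNs, hprob, hκ]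
    field_simp
  -- the normalised kernel is at most one on the diagonal because probabilities are nonnegative
  have hdiag : ∀ u, κ * ∑ i, b i u * b i u ≤ 1 := by
    intro u
    rcases eq_or_ne (prob u) 0 with h | h
    · simp [hb, h]
    · have h1 := prob_nonneg (u * act p u)
      rw [hprob'] at h1
      have h2 : 0 < prob u := lt_of_le_of_ne (prob_nonneg u) h.symm
      have := nonneg_of_mul_nonneg_right h1 (by positivity)
      linarith
  have habs : ∀ u v, |κ * ∑ i, b i u * b i v| ≤ 1 := by
    intro u v
    have hu := hdiag u
    have hv := hdiag v
    have e1 : 0 ≤ κ * ∑ i, (b i u - b i v) ^ 2 := by positivity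
    have e2 : 0 ≤ κ * ∑ i, (b i u + b i v) ^ 2 := by positivity
    have f1 : ∑ i, (b i u - b i v) ^ 2 =
        ∑ i, b i u * b i u + ∑ i, b i v * b i v - 2 * ∑ i, b i u * b i v := by
      rw [Finset.mul_sum, ← Finset.sum_add_distrib, ← Finset.sum_sub_distrib]
      exact Finset.sum_congr rfl fun i _ => by ring
    have f2 : ∑ i, (b i u + b i v) ^ 2 =
        ∑ i, b i u * b i u + ∑ i, b i v * b i v + 2 * ∑ i, b i u * b i v := by
      rw [Finset.mul_sum, ← Finset.sum_add_distrib, ← Finset.sum_add_distrib]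
      exact Finset.sum_congr rfl fun i _ => by ring
    rw [f1] at e1
    rw [f2] at e2
    rw [abs_le]
    constructor <;> nlinarith
  have hent : ∀ u v, ent (u * act p v) =
      prob (u * act p v) * (Real.log (c * q) + Real.log (prob u))
      + prob (u * act p v) * Real.log (prob v)
      + c * q * (prob u * prob v * ((1 - κ * ∑ i, b i u * b i v) *
        Real.log (1 - κ * ∑ i, b i u * b i v) + κ * ∑ i, b i u * b i v))
      - c * q * κ * ∑ i, β i u * β i v := by
    intro u v
    have e := hprob' u v
    have e' := hNs u v
    rcases eq_or_ne (prob (u * act p v)) 0 with h | h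
    · rw [h] at e
      rw [ent, h]
      have h3 : prob u * prob v * (1 - κ * ∑ i, b i u * b i v) = 0 := by
        rw [eq_comm, mul_assoc] at e
        exact (mul_eq_zero.1 e).resolve_left hc.ne'
      linear_combination (-(c * q) * Real.log (1 - κ * ∑ i, b i u * b i v)) * h3 - c * q * e'
    · have hu : prob u ≠ 0 := fun h' => h (by rw [e, h']; ring)
      have hv : prob v ≠ 0 := fun h' => h (by rw [e, h']; ring)
      have hs : 1 - κ * ∑ i, b i u * b i v ≠ 0 := fun h' => h (by rw [e, h']; ring)
      have hlog : Real.log (prob (u * act p v)) = Real.log (c * q) + Real.log (prob u)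
          + Real.log (prob v) + Real.log (1 - κ * ∑ i, b i u * b i v) := by
        rw [e, Real.log_mul (by positivity) hs, Real.log_mul hc.ne' (by positivity),
          Real.log_mul hu hv]
        ring
      rw [ent, hlog]
      linear_combination (Real.log (1 - κ * ∑ i, b i u * b i v)) * e - c * q * e'
  -- the terms that are linear in one of the two arguments vanish
  have z1 : ∀ u, expect (fun v => prob (u * act p v)) Q = 0 := by
    intro u
    have : (fun v : Lik q => prob (u * act p v)) =
        fun v => ∑ x, ((act p u x : ℝ) / q) * (v x : ℝ) := by
      ext v
      rw [prob_mul_act hp, prob, Finset.sum_div]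
      exact Finset.sum_congr rfl fun x _ => by
        rw [Pi.mul_apply, NNReal.coe_mul]; ring
    rw [this]
    exact expect_linear_eq_zero hQ _
  have z2 : ∀ v, expect (fun u => prob (u * act p v)) Q = 0 := by
    intro v
    simp only [prob_mul_act hp, mul_comm _ v]
    simp only [← prob_mul_act hp, z1]
  have z3 : ∀ i, expect (β i) Q = 0 := fun i => expect_linear_eq_zero hQ _
  have hfin : entropy (Q * push p Q) = c * q * expect (fun u => expect (fun v => prob u * prob v *
      ((1 - κ * ∑ i, b i u * b i v) * Real.log (1 - κ * ∑ i, b i u * b i v) +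
        κ * ∑ i, b i u * b i v)) Q) Q := by
    rw [entropy, expect_mul]
    simp only [expect_push, hent, expect_sub_fun, expect_add_fun, expect_mul_const,
      expect_const_mul, expect_sum_fun, z1, z3]
    rw [expect_swap (fun u v => prob (u * act p v) * Real.log (prob v))]
    simp only [expect_mul_const, z2]
    simp [expect_apply]
  rw [hfin]
  exact mul_nonneg hc.le (expect_one_sub_mul_log_nonneg b prob hκ0.le habs Q)

/-! ### The variational argument -/

/-- The tree recursion: the observation of the colour of a vertex through its `k` children, each of
which is observed through `Q`. -/
def branch (k : ℕ) (p : Matrix (Fin q) (Fin q) ℝ≥0) (Q : LikAlg q) : LikAlg q := push p Q ^ k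

/-- The complexity of a finite channel. The entropies of the individual channels, which turn the two
terms into mutual informations, cancel. -/
def channelComplexity (k : ℕ) (p : Matrix (Fin q) (Fin q) ℝ≥0) (Q : LikAlg q) : ℝ :=
  ((k : ℝ) + 1) / 2 * entropy (Q * push p Q) - entropy (push p Q ^ (k + 1))

lemma IsChannel.branch {Q : LikAlg q} (hQ : IsChannel Q) {p : Matrix (Fin q) (Fin q) ℝ≥0}
    (hp : IsSymmStochastic p) (k : ℕ) : IsChannel (branch k p Q) := (hQ.push hp).pow k

lemma log_card_nonneg [NeZero q] : 0 ≤ Real.log q :=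
  Real.log_nonneg (Nat.one_le_cast.2 (NeZero.one_le))

lemma entropy_mul_sub_sq_ge [NeZero q] {a b W : LikAlg q} (ha : IsChannel a) (hb : IsChannel b)
    (hW : IsChannel W) : -(4 * Real.log q) ≤ entropy (W * (b - a) ^ 2) := by
  have e : W * (b - a) ^ 2 = W * (b * b) + W * (a * a) - (2 : ℝ) • (W * (a * b)) := by
    rw [two_smul]; ring
  rw [e, map_sub, map_add, map_smul, smul_eq_mul]
  have h1 := hW.entropy_add_le (hb.mul hb)
  have h2 := hW.entropy_add_le (ha.mul ha)
  have h3 := hW.entropy_mul_le (ha.mul hb)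
  have h4 := ha.entropy_mul_le hb
  have h5 := ha.entropy_add_le ha
  have h6 := hb.entropy_add_le hb
  linarith

/-- First order expansion of the entropy of a power along a segment of channels. -/
lemma entropy_mul_pow_mix_ge [NeZero q] {a b : LikAlg q} (ha : IsChannel a) (hb : IsChannel b)
    {h : ℝ} (h0 : 0 ≤ h) (h1 : h ≤ 1) (n : ℕ) {W : LikAlg q} (hW : IsChannel W) :
    entropy (W * a ^ n) + n * h * entropy (W * a ^ (n - 1) * (b - a))
      - 2 * n * (n - 1) * Real.log q * h ^ 2 ≤ entropy (W * (a + h • (b - a)) ^ n) := by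
  induction n generalizing W with
  | zero => simp
  | succ n ih =>
    have hc := ha.mix hb h0 h1
    have key := ih (hW.mul hc)
    have e1 : W * (a + h • (b - a)) ^ (n + 1) =
        W * (a + h • (b - a)) * (a + h • (b - a)) ^ n := by ring
    have e2 : W * (a + h • (b - a)) * a ^ n =
        W * a ^ (n + 1) + h • (W * a ^ n * (b - a)) := by
      rw [mul_add, add_mul, mul_smul_comm, smul_mul_assoc]
      congr 1
      · ring
      · congr 1; ring
    rw [e1]
    rw [e2, map_add, map_smul, smul_eq_mul] at key
    rw [Nat.add_sub_cancel]
    push_cast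
    rcases n with _ | m
    · simp only [Nat.cast_zero, pow_zero, zero_mul, mul_zero, mul_one] at key ⊢
      linarith
    · have e3 : W * (a + h • (b - a)) * a ^ (m + 1 - 1) * (b - a) =
          W * a ^ (m + 1) * (b - a) + h • (W * a ^ m * (b - a) ^ 2) := by
        rw [mul_add, add_mul, add_mul, mul_smul_comm, smul_mul_assoc, smul_mul_assoc,
          Nat.add_sub_cancel]
        congr 1
        · ring
        · congr 1; ring
      rw [e3, map_add, map_smul, smul_eq_mul] at key
      have h2 := entropy_mul_sub_sq_ge ha hb (hW.mul (ha.pow m))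
      have h3 : (((m + 1 : ℕ) : ℝ) * h ^ 2) * -(4 * Real.log q) ≤
          (((m + 1 : ℕ) : ℝ) * h ^ 2) * entropy (W * a ^ m * (b - a) ^ 2) :=
        mul_le_mul_of_nonneg_left h2 (by positivity)
      push_cast at key h3 ⊢
      linarith

lemma entropy_edge_add {p : Matrix (Fin q) (Fin q) ℝ≥0} (hp : IsSymmStochastic p)
    (Q D : LikAlg q) (h : ℝ) : entropy ((Q + h • D) * push p (Q + h • D)) =
      entropy (Q * push p Q) + 2 * h * entropy (Q * push p D) + h ^ 2 * entropy (D * push p D) := by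
  have : (Q + h • D) * push p (Q + h • D) =
      Q * push p Q + h • (Q * push p D) + h • (D * push p Q) + (h * h) • (D * push p D) := by
    simp only [map_add, map_smul, add_mul, mul_add, smul_mul_assoc, mul_smul_comm, smul_add,
      smul_smul]
    abel
  rw [this]
  simp only [map_add, map_smul, smul_eq_mul]
  rw [entropy_mul_push_symm hp D Q]
  ring

lemma entropy_edge_sub_le [NeZero q] {p : Matrix (Fin q) (Fin q) ℝ≥0} (hp : IsSymmStochastic p)
    {U V : LikAlg q} (hU : IsChannel U) (hV : IsChannel V) :
    entropy ((U - V) * push p (U - V)) ≤ 2 * Real.log q := by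
  have e : U - V = U + (-1 : ℝ) • V := by module
  rw [e, entropy_edge_add hp]
  have h1 := hU.entropy_mul_le (hU.push hp)
  have h2 := hU.entropy_add_le (hV.push hp)
  have h3 := hV.entropy_mul_le (hV.push hp)
  simp only [entropy_push hp] at h1 h2 h3
  linarith

/-- Moving towards `branch k p Q` lowers the complexity to first order, since its derivative in this
direction is minus a nonnegative quadratic form. -/
lemma channelComplexity_mix_le [NeZero q] {p : Matrix (Fin q) (Fin q) ℝ≥0}
    (hp : IsSymmStochastic p) (k : ℕ) {Q : LikAlg q} (hQ : IsChannel Q) {h : ℝ} (h0 : 0 ≤ h)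
    (h1 : h ≤ 1) :
    channelComplexity k p (Q + h • (branch k p Q - Q)) ≤ channelComplexity k p Q
      - (k + 1) * h * entropy ((branch k p Q - Q) * push p (branch k p Q - Q))
      + (k + 1) * (2 * k + 1) * Real.log q * h ^ 2 := by
  have hR := hQ.branch hp k
  set R := branch k p Q with hRdef
  have hk := entropy_mul_pow_mix_ge (hQ.push hp) (hR.push hp) h0 h1 (k + 1) isChannel_one
  simp only [one_mul, Nat.add_sub_cancel] at hk
  have e1 : push p Q ^ k = R := rfl
  have hbound := entropy_edge_sub_le hp hR hQ
  have e2 : entropy ((R - Q) * push p (R - Q)) =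
      entropy (R * push p (R - Q)) - entropy (Q * push p (R - Q)) := by
    rw [sub_mul, map_sub]
  rw [e1, ← map_sub, ← map_smul, ← map_add] at hk
  unfold channelComplexity
  rw [entropy_edge_add hp]
  have h3 : ((k : ℝ) + 1) / 2 * h ^ 2 * entropy ((R - Q) * push p (R - Q)) ≤
      ((k : ℝ) + 1) / 2 * h ^ 2 * (2 * Real.log q) :=
    mul_le_mul_of_nonneg_left hbound (by positivity)
  push_cast at hk
  rw [e2] at h3 ⊢
  linarith

/-- The Cauchy–Schwarz inequality for the edge information, in additive form. -/
lemma two_mul_entropy_edge_le [NeZero q] {p : Matrix (Fin q) (Fin q) ℝ≥0}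
    (hp : IsSymmStochastic p) (hfr : IsFrustrated (realMatrix p)) {C D : LikAlg q}
    (hC : ∀ x, total x C = 0) (hD : ∀ x, total x D = 0) {t : ℝ} (ht : 0 < t) :
    2 * entropy (C * push p D) ≤
      t * entropy (C * push p C) + entropy (D * push p D) / t := by
  have h := entropy_mul_push_nonneg hp hfr (Q := D + (-t) • C) (by simp [hC, hD])
  rw [entropy_edge_add hp, entropy_mul_push_symm hp D C] at h
  have h2 : t * (2 * entropy (C * push p D)) ≤
      t * (t * entropy (C * push p C) + entropy (D * push p D) / t) := by
    rw [mul_add, mul_div_cancel₀ _ ht.ne']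
    linarith
  exact le_of_mul_le_mul_left h2 ht

/-- The tree recursion changes the complexity of `Q` little when `branch k p Q` is close to `Q`. -/
lemma channelComplexity_branch_le [NeZero q] {p : Matrix (Fin q) (Fin q) ℝ≥0}
    (hp : IsSymmStochastic p) (hfr : IsFrustrated (realMatrix p)) (k : ℕ) {Q : LikAlg q}
    (hQ : IsChannel Q) {t : ℝ} (ht : 0 < t) :
    channelComplexity k p (branch k p Q) ≤ channelComplexity k p Q + (k + 1) / 2 *
      (t * (2 * Real.log q) +
        entropy ((branch k p Q - Q) * push p (branch k p Q - Q)) / t) := by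
  have hR := hQ.branch hp k
  set R := branch k p Q with hRdef
  set M := Q + (1 / 2 : ℝ) • (R - Q) with hM
  have hMc : IsChannel M := hQ.mix hR (by norm_num) (by norm_num)
  set U : ℕ → LikAlg q := fun j => push p R ^ j * push p Q ^ (k + 1 - 1 - j) with hU
  have hUc : ∀ j, IsChannel (U j) := fun j => ((hR.push hp).pow j).mul ((hQ.push hp).pow _)
  have e1 : entropy (push p R ^ (k + 1)) - entropy (push p Q ^ (k + 1)) =
      ∑ j ∈ Finset.range (k + 1), entropy (U j * push p (R - Q)) := by
    rw [← map_sub, ← geom_sum₂_mul, Finset.sum_mul, map_sum, map_sub]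
  have e2 : entropy (R * push p R) - entropy (Q * push p Q) =
      2 * entropy (M * push p (R - Q)) := by
    have h := entropy_edge_add hp Q (R - Q) 1
    rw [one_smul, add_sub_cancel] at h
    rw [h, hM, add_mul, map_add, smul_mul_assoc, map_smul, smul_eq_mul]
    ring
  have e3 : ∀ j, 2 * (entropy (M * push p (R - Q)) - entropy (U j * push p (R - Q))) ≤
      t * (2 * Real.log q) + entropy ((R - Q) * push p (R - Q)) / t := by
    intro j
    rw [← map_sub, ← sub_mul]
    refine (two_mul_entropy_edge_le hp hfr (C := M - U j) (D := R - Q) ?_ ?_ ht).trans ?_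
    · intro x; simp [hMc.total_eq, (hUc j).total_eq]
    · intro x; simp [hR.total_eq, hQ.total_eq]
    · gcongr
      exact entropy_edge_sub_le hp hMc (hUc j)
  have e4 := Finset.sum_le_sum fun j (_ : j ∈ Finset.range (k + 1)) => e3 j
  rw [← Finset.mul_sum, Finset.sum_sub_distrib, ← e1, Finset.sum_const, Finset.sum_const,
    Finset.card_range, nsmul_eq_mul, nsmul_eq_mul] at e4
  push_cast at e4
  unfold channelComplexity
  have e5 : ((k : ℝ) + 1) / 2 * (entropy (R * push p R) - entropy (Q * push p Q)) =
      (k + 1) * entropy (M * push p (R - Q)) := by rw [e2]; ring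
  linarith

/-- Approximate minimisers of the complexity are mapped to approximate minimisers by the tree
recursion. -/
lemma exists_channelComplexity_branch_le [NeZero q] {p : Matrix (Fin q) (Fin q) ℝ≥0}
    (hp : IsSymmStochastic p) (hfr : IsFrustrated (realMatrix p)) (k : ℕ) {m : ℝ}
    (hm : ∀ Q, IsChannel Q → m ≤ channelComplexity k p Q) {ε : ℝ} (hε : 0 < ε) :
    ∃ δ > 0, ∀ Q, IsChannel Q → channelComplexity k p Q ≤ m + δ →
      channelComplexity k p (branch k p Q) ≤ m + ε := by
  set L := Real.log q with hL
  have hL0 : 0 ≤ L := log_card_nonneg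
  set C : ℝ := (k + 1) * (2 * k + 1) * L with hC
  have hC0 : 0 ≤ C := by positivity
  set D : ℝ := 1 + (k + 1) / 2 * (2 * L + (1 + C)) with hD
  have hD0 : 0 < D := by positivity
  -- With step `t ^ 2` and slack `t ^ 4` all error terms are of order `t`.
  set t : ℝ := min 1 (ε / D) with ht
  have ht0 : 0 < t := lt_min one_pos (by positivity)
  have ht1 : t ≤ 1 := min_le_left _ _
  have htD : D * t ≤ ε := by
    have := min_le_right 1 (ε / D)
    rw [← ht, le_div_iff₀ hD0] at this
    linarith
  refine ⟨t ^ 4, by positivity, fun Q hQ hQm => ?_⟩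
  have h1 := hm _ (hQ.mix (hQ.branch hp k) (sq_nonneg t) (pow_le_one₀ ht0.le ht1))
  have h2 := channelComplexity_mix_le hp k hQ (sq_nonneg t) (pow_le_one₀ ht0.le ht1)
  have h3 := channelComplexity_branch_le hp hfr k hQ ht0
  set N := entropy ((branch k p Q - Q) * push p (branch k p Q - Q)) with hN
  have hN0 : 0 ≤ N := entropy_mul_push_nonneg hp hfr fun x => by
    simp [hQ.total_eq, (hQ.branch hp k).total_eq]
  have h4 : t ^ 2 * ((k + 1) * N) ≤ t ^ 2 * ((1 + C) * t ^ 2) := by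
    rw [← hC] at h2
    nlinarith
  have h5 := le_of_mul_le_mul_left h4 (by positivity)
  have h6 : N ≤ (1 + C) * t ^ 2 := by
    have : 0 ≤ (k : ℝ) * N := by positivity
    linarith
  have h7 : N / t ≤ (1 + C) * t := by
    rw [div_le_iff₀ ht0]
    linarith
  have h8 : t ^ 4 ≤ t := pow_le_of_le_one ht0.le ht1 (by norm_num)
  have h9 : ((k : ℝ) + 1) / 2 * (t * (2 * L) + N / t) ≤
      (k + 1) / 2 * (t * (2 * L) + (1 + C) * t) := by gcongr
  rw [hD] at htD
  linarith

lemma IsChannel.iterate_branch {Q : LikAlg q} (hQ : IsChannel Q)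
    {p : Matrix (Fin q) (Fin q) ℝ≥0} (hp : IsSymmStochastic p) (k l : ℕ) :
    IsChannel ((TreeReconstruction.branch k p)^[l] Q) := by
  induction l with
  | zero => exact hQ
  | succ l ih => rw [Function.iterate_succ_apply']; exact ih.branch hp k

lemma LessInformative.iterate_branch {Q R : LikAlg q} (h : LessInformative Q R)
    (hQ : IsChannel Q) (hR : IsChannel R) {p : Matrix (Fin q) (Fin q) ℝ≥0}
    (hp : IsSymmStochastic p) (k l : ℕ) :
    LessInformative ((branch k p)^[l] Q) ((branch k p)^[l] R) := by
  induction l with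
  | zero => exact h
  | succ l ih =>
    rw [Function.iterate_succ_apply', Function.iterate_succ_apply']
    exact (ih.push p).pow ((hQ.iterate_branch hp k l).push hp)
      ((hR.iterate_branch hp k l).push hp) k

lemma exists_channelComplexity_iterate_le [NeZero q] {p : Matrix (Fin q) (Fin q) ℝ≥0}
    (hp : IsSymmStochastic p) (hfr : IsFrustrated (realMatrix p)) (k : ℕ) {m : ℝ}
    (hm : ∀ Q, IsChannel Q → m ≤ channelComplexity k p Q) (l : ℕ) {ε : ℝ} (hε : 0 < ε) :
    ∃ δ > 0, ∀ Q, IsChannel Q → channelComplexity k p Q ≤ m + δ →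
      channelComplexity k p ((branch k p)^[l] Q) ≤ m + ε := by
  induction l generalizing ε with
  | zero => exact ⟨ε, hε, fun Q _ h => h⟩
  | succ l ih =>
    obtain ⟨δ, hδ, h⟩ := exists_channelComplexity_branch_le hp hfr k hm hε
    obtain ⟨δ', hδ', h'⟩ := ih hδ
    refine ⟨δ', hδ', fun Q hQ hQm => ?_⟩
    rw [Function.iterate_succ_apply']
    exact h _ (hQ.iterate_branch hp k l) (h' Q hQ hQm)

lemma channelComplexity_ge [NeZero q] {p : Matrix (Fin q) (Fin q) ℝ≥0} (hp : IsSymmStochastic p)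
    (k : ℕ) {Q : LikAlg q} (hQ : IsChannel Q) :
    -((k + 1) * rootMutualInfo Q) ≤ channelComplexity k p Q := by
  have h1 : ∀ n : ℕ, entropy (push p Q ^ n) ≤ n * (entropy Q + rootMutualInfo Q) := by
    intro n
    induction n with
    | zero => simp [entropy_one]
    | succ n ih =>
      have hU := (hQ.push hp).pow n
      have := (hU.push hp).entropy_mul_le_rootMutualInfo hQ
      rw [← entropy_mul_push_comm hp, entropy_push hp, ← pow_succ] at this
      push_cast
      linarith
  have h2 := hQ.entropy_add_le (hQ.push hp)
  rw [entropy_push hp] at h2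
  have h3 := h1 (k + 1)
  have h4 : ((k : ℝ) + 1) / 2 * (entropy Q + entropy Q) ≤
      ((k : ℝ) + 1) / 2 * entropy (Q * push p Q) := by gcongr
  unfold channelComplexity
  push_cast at h3
  linarith

/-- If some finite channel has negative complexity, then the information on the root stays bounded
away from zero. -/
lemma exists_le_rootMutualInfo_iterate [NeZero q] {p : Matrix (Fin q) (Fin q) ℝ≥0}
    (hp : IsSymmStochastic p) (hfr : IsFrustrated (realMatrix p)) (k : ℕ)
    (hneg : ∃ Q, IsChannel Q ∧ channelComplexity k p Q < 0) :
    ∃ c > 0, ∀ l, c ≤ rootMutualInfo ((branch k p)^[l] (perfect q)) := by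
  obtain ⟨Q₀, hQ₀, hneg⟩ := hneg
  set S : Set ℝ := channelComplexity k p '' {Q | IsChannel Q} with hS
  have hbdd : BddBelow S := by
    refine ⟨-((k + 1) * Real.log q), ?_⟩
    rintro _ ⟨Q, hQ, rfl⟩
    have h := hQ.lessInformative_perfect.rootMutualInfo_le
    rw [rootMutualInfo_perfect] at h
    refine le_trans ?_ (channelComplexity_ge hp k hQ)
    have : ((k : ℝ) + 1) * rootMutualInfo Q ≤ (k + 1) * Real.log q := by gcongr
    linarith
  have hm : ∀ Q, IsChannel Q → sInf S ≤ channelComplexity k p Q :=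
    fun Q hQ => csInf_le hbdd ⟨Q, hQ, rfl⟩
  have hm0 : sInf S < 0 := (hm Q₀ hQ₀).trans_lt hneg
  refine ⟨-(sInf S / 2) / (k + 1), div_pos (by linarith) (by positivity), fun l => ?_⟩
  obtain ⟨δ, hδ, h⟩ := exists_channelComplexity_iterate_le hp hfr k hm l
    (show 0 < -(sInf S / 2) by linarith)
  obtain ⟨_, ⟨Q, hQ, rfl⟩, hQm⟩ := Real.lt_sInf_add_pos (s := S) ⟨_, Q₀, hQ₀, rfl⟩ hδ
  have h1 := h Q hQ hQm.le
  have h2 := channelComplexity_ge hp k (hQ.iterate_branch hp k l)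
  have h3 :=
    (hQ.lessInformative_perfect.iterate_branch hQ isChannel_perfect hp k l).rootMutualInfo_le
  rw [div_le_iff₀ (by positivity)]
  have h4 : ((k : ℝ) + 1) * rootMutualInfo ((branch k p)^[l] Q) ≤
      (k + 1) * rootMutualInfo ((branch k p)^[l] (perfect q)) := by gcongr
  linarith

lemma antitone_rootMutualInfo_iterate [NeZero q] {p : Matrix (Fin q) (Fin q) ℝ≥0}
    (hp : IsSymmStochastic p) (k : ℕ) :
    Antitone fun l => rootMutualInfo ((branch k p)^[l] (perfect q)) := by
  refine antitone_nat_of_succ_le fun l => ?_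
  rw [Function.iterate_succ_apply]
  have h := isChannel_perfect.branch hp k (Q := perfect q)
  exact (h.lessInformative_perfect.iterate_branch h isChannel_perfect hp k l).rootMutualInfo_le

/-! ### The broadcast process as iterates of the tree recursion -/

/-- A configuration of generation `l + 1` is a family of configurations of generation `l`, one for
each of the `k` subtrees at the root. -/
def subtreeEquiv (k l : ℕ) (α : Type*) : (Gen k (l + 1) → α) ≃ (Fin k → Gen k l → α) :=
  ((Fin.consEquiv fun _ => Fin k).symm.arrowCongr (Equiv.refl α)).trans
    (Equiv.curry (Fin k) (Gen k l) α)

lemma subtreeEquiv_apply {k l : ℕ} {α : Type*} (σ : Gen k (l + 1) → α) (i : Fin k) (v : Gen k l) :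
    subtreeEquiv k l α σ i v = σ (Fin.cons i v) := rfl

lemma prod_gen_succ {k l : ℕ} (f : Gen k (l + 1) → ℝ) :
    ∏ v, f v = ∏ i : Fin k, ∏ v : Gen k l, f (Fin.cons i v) := by
  rw [← Fintype.prod_prod_type' fun i v => f (Fin.cons i v)]
  exact (Fintype.prod_equiv (Fin.consEquiv fun _ => Fin k) _ _ fun _ => rfl).symm

lemma init_cons_succ {k l : ℕ} (i : Fin k) (v : Gen k (l + 1)) :
    (Fin.init (Fin.cons i v : Gen k (l + 2)) : Gen k (l + 1)) = Fin.cons i (Fin.init v) := by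
  funext j
  refine Fin.cases ?_ (fun j => ?_) j <;> rfl

/-- The broadcast is defined by adding a generation at the leaves; this is the recursion obtained by
splitting off the root. -/
lemma broadcast_succ_root (k : ℕ) (π : Matrix (Fin q) (Fin q) ℝ) (x : Fin q) (l : ℕ)
    (τ : Gen k (l + 1) → Fin q) : broadcast k π x (l + 1) τ =
      ∏ i, ∑ y, π x y * broadcast k π y l (subtreeEquiv k l (Fin q) τ i) := by
  induction l with
  | zero =>
    rw [broadcast, Finset.sum_eq_single fun _ => x]
    · rw [prod_gen_succ]
      simp only [broadcast, if_true, one_mul]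
      refine Finset.prod_congr rfl fun i _ => ?_
      rw [Fintype.prod_unique]
      rw [Subsingleton.elim default (Fin.elim0 : Gen k 0)]
      simp only [subtreeEquiv_apply]
      rw [Finset.sum_eq_single (τ (Fin.cons i Fin.elim0))]
      · simp
      · intro y _ hy; simp [hy.symm]
      · simp
    · intro σ _ hσ
      have : σ Fin.elim0 ≠ x := fun h => hσ (funext fun v => by
        rw [Subsingleton.elim v Fin.elim0, h])
      simp [broadcast, this]
    · simp
  | succ l ih =>
    rw [broadcast]
    set G : Fin k → (Gen k l → Fin q) → ℝ := fun i s =>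
      (∑ y, π x y * broadcast k π y l s) *
        ∏ v : Gen k (l + 1), π (s (Fin.init v)) (subtreeEquiv k (l + 1) (Fin q) τ i v) with hG
    have e1 : ∀ σ : Gen k (l + 1) → Fin q,
        broadcast k π x (l + 1) σ * ∏ v : Gen k (l + 2), π (σ (Fin.init v)) (τ v) =
          ∏ i, G i (subtreeEquiv k l (Fin q) σ i) := by
      intro σ
      rw [ih, prod_gen_succ, ← Finset.prod_mul_distrib]
      refine Finset.prod_congr rfl fun i _ => ?_
      simp only [hG, init_cons_succ]
      rfl
    rw [Finset.sum_congr rfl fun σ _ => e1 σ,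
      (subtreeEquiv k l (Fin q)).sum_comp fun s => ∏ i, G i (s i), ← Fintype.prod_sum]
    refine Finset.prod_congr rfl fun i _ => ?_
    simp only [hG, Finset.sum_mul, broadcast, Finset.mul_sum]
    rw [Finset.sum_comm]
    exact Finset.sum_congr rfl fun y _ => Finset.sum_congr rfl fun s _ => by ring

lemma broadcast_nonneg (k : ℕ) {π : Matrix (Fin q) (Fin q) ℝ} (hπ : ∀ x y, 0 ≤ π x y) (x : Fin q)
    (l : ℕ) (σ : Gen k l → Fin q) : 0 ≤ broadcast k π x l σ := by
  induction l with
  | zero => rw [broadcast]; positivity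
  | succ l ih =>
    rw [broadcast]
    exact Finset.sum_nonneg fun s _ => mul_nonneg (ih s) (Finset.prod_nonneg fun v _ => hπ _ _)

/-- The likelihood vector of a configuration of generation `l`. -/
def configLik (k : ℕ) (p : Matrix (Fin q) (Fin q) ℝ≥0) (l : ℕ) (σ : Gen k l → Fin q) : Lik q :=
  fun x => (broadcast k (realMatrix p) x l σ).toNNReal

lemma coe_configLik (k : ℕ) (p : Matrix (Fin q) (Fin q) ℝ≥0) (l : ℕ) (σ : Gen k l → Fin q)
    (x : Fin q) : (configLik k p l σ x : ℝ) = broadcast k (realMatrix p) x l σ :=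
  Real.coe_toNNReal _ (broadcast_nonneg k (fun _ _ => NNReal.coe_nonneg _) x l σ)

lemma iterate_branch_perfect (k : ℕ) (p : Matrix (Fin q) (Fin q) ℝ≥0) (l : ℕ) :
    (branch k p)^[l] (perfect q) = ∑ σ, MonoidAlgebra.single (configLik k p l σ) 1 := by
  induction l with
  | zero =>
    rw [Function.iterate_zero, id, perfect, ← (Equiv.funUnique (Gen k 0) (Fin q)).sum_comp]
    refine Finset.sum_congr rfl fun σ _ => ?_
    congr 1
    ext x
    rw [coe_configLik]
    simp only [broadcast]
    simp only [Equiv.funUnique_apply, Pi.single_apply]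
    rw [Subsingleton.elim default (Fin.elim0 : Gen k 0)]
    simp only [eq_comm]
    split_ifs <;> simp
  | succ l ih =>
    rw [Function.iterate_succ_apply', ih, branch, map_sum]
    simp only [push_single]
    rw [← Fin.prod_const, Fintype.prod_sum, ← (subtreeEquiv k l (Fin q)).sum_comp]
    refine Finset.sum_congr rfl fun τ _ => ?_
    have h := map_prod (MonoidAlgebra.of ℝ (Lik q))
      (fun i => act p (configLik k p l (subtreeEquiv k l (Fin q) τ i))) Finset.univ
    simp only [MonoidAlgebra.of_apply] at h
    rw [← h]
    congr 1
    ext x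
    rw [coe_configLik, broadcast_succ_root, Finset.prod_apply, NNReal.coe_prod]
    simp only [act, NNReal.coe_sum, NNReal.coe_mul, coe_configLik]
    rfl

lemma rootInfo_eq [NeZero q] {p : Matrix (Fin q) (Fin q) ℝ≥0} (hp : IsSymmStochastic p)
    (k l : ℕ) : rootInfo k (realMatrix p) l =
      rootMutualInfo ((branch k p)^[l] (perfect q)) / Real.log 2 := by
  have hq : (q : ℝ) ≠ 0 := NeZero.ne _
  have htot : ∀ x, ∑ σ, broadcast k (realMatrix p) x l σ = 1 := by
    intro x
    have := (isChannel_perfect.iterate_branch hp k l).total_eq x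
    rw [iterate_branch_perfect] at this
    simpa [total, coe_configLik] using this
  have hprob : ∀ σ, ∑ x, 1 / (q : ℝ) * broadcast k (realMatrix p) x l σ =
      prob (configLik k p l σ) := by
    intro σ
    simp only [prob, coe_configLik]
    rw [← Finset.mul_sum]
    ring
  have hsingle : ∀ (w : Lik q) (x : Fin q), prob (w * Pi.single x 1) = 1 / q * (w x : ℝ) := by
    intro w x
    unfold prob
    rw [Finset.sum_eq_single x]
    · simp; ring
    · intro y _ hy; simp [hy]
    · simp
  rw [iterate_branch_perfect, rootMutualInfo, map_sum, rootInfo, mutualInfo, Finset.sum_comm,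
    Finset.sum_div]
  refine Finset.sum_congr rfl fun σ _ => ?_
  rw [expect_single, one_mul, Finset.sum_div]
  refine Finset.sum_congr rfl fun x _ => ?_
  rw [← Finset.mul_sum, htot, hprob, infoKernel, ent, hsingle, prob_single, coe_configLik]
  set b := 1 / (q : ℝ) * broadcast k (realMatrix p) x l σ with hb
  rcases eq_or_ne b 0 with h | h
  · simp [h]
  · have hw : prob (configLik k p l σ) ≠ 0 := by
      intro h0
      have := prob_mul_eq_zero (v := Pi.single x 1) h0
      rw [mul_comm, hsingle, coe_configLik] at this
      exact h this
    rw [Real.logb, Real.log_div h (by positivity), mul_one,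
      Real.log_mul (by positivity) hw]
    ring

/-! ### Discretisation of consistent distributions -/

/-- The likelihood vector, proportional to a probability distribution `η`, that has probability one
under the uniform input. -/
def simplexLik (η : Simplex q) : Lik q := fun x => ((q : ℝ) * (η : Fin q → ℝ) x).toNNReal

lemma simplex_nonneg (η : Simplex q) (x : Fin q) : 0 ≤ (η : Fin q → ℝ) x := η.2.1 x

lemma simplex_le_one (η : Simplex q) (x : Fin q) : (η : Fin q → ℝ) x ≤ 1 :=
  (Finset.single_le_sum (fun y _ => simplex_nonneg η y) (Finset.mem_univ x)).trans_eq η.2.2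

lemma continuous_simplex_apply (x : Fin q) : Continuous fun η : Simplex q => (η : Fin q → ℝ) x :=
  (continuous_apply x).comp continuous_subtype_val

lemma coe_simplexLik (η : Simplex q) (x : Fin q) :
    (simplexLik η x : ℝ) = q * (η : Fin q → ℝ) x :=
  Real.coe_toNNReal _ (mul_nonneg (Nat.cast_nonneg _) (simplex_nonneg η x))

/-- The finite channel whose posterior distributions are `b j`, with probabilities `c j`. -/
def discreteChannel {ι : Type*} [Fintype ι] (c : ι → ℝ) (b : ι → Simplex q) : LikAlg q :=
  ∑ j, MonoidAlgebra.single (simplexLik (b j)) (c j)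

lemma isChannel_discreteChannel [NeZero q] {ι : Type*} [Fintype ι] {c : ι → ℝ}
    {b : ι → Simplex q} (hc : ∀ j, 0 ≤ c j)
    (hb : ∀ x, ∑ j, c j * (b j : Fin q → ℝ) x = 1 / (q : ℝ)) :
    IsChannel (discreteChannel c b) where
  pos := isPos_sum _ _ fun j _ => isPos_single _ (hc j)
  total_eq x := by
    have hq : (q : ℝ) ≠ 0 := NeZero.ne _
    have : ∀ j, c j * ((q : ℝ) * (b j : Fin q → ℝ) x) = q * (c j * (b j : Fin q → ℝ) x) :=
      fun j => by ring
    simp only [total, discreteChannel, map_sum, expect_single, coe_simplexLik, this]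
    rw [← Finset.mul_sum, hb, mul_one_div_cancel hq]

lemma edgeSum_unif [NeZero q] {p : Matrix (Fin q) (Fin q) ℝ≥0} (hp : IsSymmStochastic p) :
    edgeSum (realMatrix p) (unif q) (unif q) = 1 / q := by
  have hq : (q : ℝ) ≠ 0 := NeZero.ne _
  simp only [edgeSum, unif, realMatrix, ← Finset.mul_sum, hp.sum_eq]
  simp [hq]

lemma vertexSum_unif [NeZero q] {p : Matrix (Fin q) (Fin q) ℝ≥0} (hp : IsSymmStochastic p)
    (n : ℕ) : vertexSum (realMatrix p) (fun _ : Fin n => unif q) = q * (1 / q) ^ n := by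
  simp only [vertexSum, unif, realMatrix, ← Finset.mul_sum, hp.sum_eq]
  simp

lemma edgeTerm_eq [NeZero q] {p : Matrix (Fin q) (Fin q) ℝ≥0} (hp : IsSymmStochastic p)
    (η₁ η₂ : Simplex q) : edgeTerm (realMatrix p) η₁ η₂ =
      -ent (simplexLik η₁ * act p (simplexLik η₂)) := by
  have hq : (q : ℝ) ≠ 0 := NeZero.ne _
  have : edgeSum (realMatrix p) η₁ η₂ / edgeSum (realMatrix p) (unif q) (unif q) =
      prob (simplexLik η₁ * act p (simplexLik η₂)) := by
    rw [edgeSum_unif hp, prob, edgeSum, Finset.sum_div, Finset.sum_div]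
    refine Finset.sum_congr rfl fun x _ => ?_
    simp only [Pi.mul_apply, act, NNReal.coe_mul, NNReal.coe_sum, coe_simplexLik, Finset.mul_sum,
      Finset.sum_div, realMatrix]
    exact Finset.sum_congr rfl fun y _ => by field_simp
  rw [edgeTerm, this, ent, neg_mul]

lemma vertexTerm_eq [NeZero q] {p : Matrix (Fin q) (Fin q) ℝ≥0} (hp : IsSymmStochastic p) {n : ℕ}
    (η : Fin n → Simplex q) : vertexTerm (realMatrix p) (fun i => (η i : Fin q → ℝ)) =
      -ent (∏ i, act p (simplexLik (η i))) := by
  have hq : (q : ℝ) ≠ 0 := NeZero.ne _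
  have : vertexSum (realMatrix p) (fun i => (η i : Fin q → ℝ)) /
      vertexSum (realMatrix p) (fun _ : Fin n => unif q) =
      prob (∏ i, act p (simplexLik (η i))) := by
    rw [vertexSum_unif hp, prob, vertexSum, Finset.sum_div, Finset.sum_div]
    refine Finset.sum_congr rfl fun x _ => ?_
    have e : ∀ i, ((act p (simplexLik (η i)) x : ℝ≥0) : ℝ) =
        q * ∑ y, (η i : Fin q → ℝ) y * realMatrix p x y := by
      intro i
      simp only [act, NNReal.coe_mul, NNReal.coe_sum, coe_simplexLik, Finset.mul_sum, realMatrix]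
      exact Finset.sum_congr rfl fun y _ => by ring
    rw [Finset.prod_apply, NNReal.coe_prod]
    simp only [e, Finset.prod_mul_distrib, Finset.prod_const, Finset.card_univ, Fintype.card_fin,
      one_div, inv_pow]
    field_simp
  rw [vertexTerm, this, ent, neg_mul]

lemma channelComplexity_discreteChannel [NeZero q] {p : Matrix (Fin q) (Fin q) ℝ≥0}
    (hp : IsSymmStochastic p) (k : ℕ) {ι : Type*} [Fintype ι] (c : ι → ℝ) (b : ι → Simplex q) :
    channelComplexity k p (discreteChannel c b) =
      -(((k : ℝ) + 1) / 2) * ∑ i : ι × ι, c i.1 * c i.2 * edgeTerm (realMatrix p) (b i.1) (b i.2) +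
      ∑ a : Fin (k + 1) → ι, (∏ i, c (a i)) *
        vertexTerm (realMatrix p) (fun i => (b (a i) : Fin q → ℝ)) := by
  classical
  have e1 : entropy (discreteChannel c b * push p (discreteChannel c b)) =
      -∑ i : ι × ι, c i.1 * c i.2 * edgeTerm (realMatrix p) (b i.1) (b i.2) := by
    simp only [discreteChannel, map_sum, push_single, Finset.sum_mul_sum, edgeTerm_eq hp,
      MonoidAlgebra.single_mul_single, entropy, expect_single]
    rw [Fintype.sum_prod_type, ← Finset.sum_neg_distrib]
    refine Finset.sum_congr rfl fun i _ => ?_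
    rw [← Finset.sum_neg_distrib]
    exact Finset.sum_congr rfl fun j _ => by ring
  have e2 : entropy (push p (discreteChannel c b) ^ (k + 1)) =
      -∑ a : Fin (k + 1) → ι, (∏ i, c (a i)) *
        vertexTerm (realMatrix p) (fun i => (b (a i) : Fin q → ℝ)) := by
    rw [← Fin.prod_const]
    simp only [discreteChannel, map_sum, push_single]
    rw [Fintype.prod_sum, map_sum, ← Finset.sum_neg_distrib]
    refine Finset.sum_congr rfl fun a _ => ?_
    have h := map_prod (MonoidAlgebra.singleHom (R := ℝ) (M := Lik q))
      (fun i => (c (a i), act p (simplexLik (b (a i))))) Finset.univ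
    simp only [MonoidAlgebra.singleHom_apply, Prod.fst_prod, Prod.snd_prod] at h
    rw [← h, entropy, expect_single, vertexTerm_eq hp]
    ring
  unfold channelComplexity
  rw [e1, e2]
  ring

/-- A barycentre of a piece of the simplex, also when the piece is a null set. -/
lemma exists_barycentre [NeZero q] (μ : Measure (Simplex q)) [IsFiniteMeasure μ]
    (S : Set (Simplex q)) (K : Set (Fin q → ℝ)) (hK : Convex ℝ K) (hKc : IsClosed K)
    (hS : MeasurableSet S) (hSK : ∀ η ∈ S, (η : Fin q → ℝ) ∈ K) :
    ∃ v : Simplex q, (S.Nonempty → (v : Fin q → ℝ) ∈ K) ∧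
      ∀ x, μ.real S * (v : Fin q → ℝ) x = ∫ η in S, (η : Fin q → ℝ) x ∂μ := by
  by_cases h0 : μ S = 0
  · have hz : ∀ x : Fin q, ∫ η in S, (η : Fin q → ℝ) x ∂μ = 0 := fun x => by
      rw [Measure.restrict_eq_zero.2 h0, integral_zero_measure]
    have hz' : μ.real S = 0 := by simp [Measure.real, h0]
    by_cases hne : S.Nonempty
    · obtain ⟨v, hv⟩ := hne
      exact ⟨v, fun _ => hSK v hv, fun x => by rw [hz, hz', zero_mul]⟩
    · exact ⟨Classical.arbitrary _, fun h => absurd h hne, fun x => by rw [hz, hz', zero_mul]⟩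
  · have hcont : Continuous fun η : Simplex q => η.1 := continuous_subtype_val
    have hint : IntegrableOn (fun η : Simplex q => η.1) S μ := by
      refine Integrable.integrableOn ?_
      obtain ⟨C, hC⟩ := isCompact_univ.exists_bound_of_continuousOn hcont.continuousOn
      exact Integrable.of_bound hcont.aestronglyMeasurable C
        (Eventually.of_forall fun η => hC η (Set.mem_univ _))
    have hmem := ((convex_stdSimplex ℝ (Fin q)).inter hK).set_average_mem
      ((isClosed_stdSimplex ℝ (Fin q)).inter hKc) h0 (measure_ne_top μ S)
      ((ae_restrict_iff' hS).2 (Eventually.of_forall fun η hη => ⟨η.2, hSK η hη⟩)) hint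
    refine ⟨⟨_, hmem.1⟩, fun _ => hmem.2, fun x => ?_⟩
    have h1 : (∫ η in S, η.1 ∂μ) x = ∫ η in S, η.1 x ∂μ :=
      ((ContinuousLinearMap.proj (R := ℝ) (φ := fun _ : Fin q => ℝ) x).integral_comp_comm
        hint).symm
    have h2 : μ.real S ≠ 0 := by
      rw [measureReal_ne_zero_iff]; exact h0
    change μ.real S * (⨍ η in S, η.1 ∂μ) x = _
    rw [setAverage_eq, Pi.smul_apply, smul_eq_mul, h1, mul_inv_cancel_left₀ h2]
    rfl

/-- The cell of a point in the subdivision of the simplex by a grid of mesh `1 / n`. -/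
def gridIndex (n : ℕ) (η : Simplex q) : Fin q → Fin (n + 1) :=
  fun x => Fin.ofNat (n + 1) ⌊(n : ℝ) * η.1 x⌋₊

lemma measurable_gridIndex (n : ℕ) : Measurable (gridIndex n : Simplex q → _) := by
  refine measurable_pi_lambda _ fun x => ?_
  refine (measurable_from_top (f := Fin.ofNat (n + 1))).comp (Measurable.nat_floor ?_)
  exact ((measurable_pi_apply x).comp measurable_subtype_coe).const_mul _

lemma gridIndex_val (n : ℕ) (η : Simplex q) (x : Fin q) :
    ((gridIndex n η x : Fin (n + 1)) : ℕ) = ⌊(n : ℝ) * η.1 x⌋₊ := by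
  have h : η.1 x ≤ 1 := simplex_le_one η x
  have : ⌊(n : ℝ) * η.1 x⌋₊ ≤ n :=
    Nat.floor_le_of_le (mul_le_of_le_one_right (Nat.cast_nonneg n) h)
  simp only [gridIndex, Fin.val_ofNat]
  exact Nat.mod_eq_of_lt (by omega)

/-- Barycentres of the grid cells: a finitely supported consistent approximation. -/
lemma exists_grid_barycentres [NeZero q] (μ : Measure (Simplex q)) [IsProbabilityMeasure μ]
    (n : ℕ) : ∃ b : (Fin q → Fin (n + 1)) → Simplex q,
      (∀ η x, (n : ℝ) * |(b (gridIndex n η)).1 x - η.1 x| ≤ 1) ∧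
      ∀ x, ∑ j, (μ.map (gridIndex n)).real {j} * (b j : Fin q → ℝ) x =
        ∫ η : Simplex q, (η : Fin q → ℝ) x ∂μ := by
  set S : (Fin q → Fin (n + 1)) → Set (Simplex q) := fun j => gridIndex n ⁻¹' {j} with hSdef
  have hS : ∀ j, MeasurableSet (S j) := fun j =>
    measurable_gridIndex n (measurableSet_singleton j)
  set K : (Fin q → Fin (n + 1)) → Set (Fin q → ℝ) := fun j =>
    {v | ∀ x, (n : ℝ) * v x ∈ Set.Icc ((j x : ℕ) : ℝ) ((j x : ℕ) + 1)} with hKdef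
  have hK : ∀ j, Convex ℝ (K j) := by
    intro j u hu v hv a c ha hc hac x
    have h := convex_Icc (𝕜 := ℝ) ((j x : ℕ) : ℝ) ((j x : ℕ) + 1) (hu x) (hv x) ha hc hac
    convert h using 1
    simp only [Pi.add_apply, Pi.smul_apply, smul_eq_mul]
    ring
  have hKc : ∀ j, IsClosed (K j) := by
    intro j
    rw [hKdef]
    simp only [Set.ofPred_forall]
    exact isClosed_iInter fun x => isClosed_Icc.preimage (by fun_prop)
  have hSK : ∀ j, ∀ η ∈ S j, (η.1 : Fin q → ℝ) ∈ K j := by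
    rintro _ η rfl x
    rw [gridIndex_val]
    exact ⟨Nat.floor_le (mul_nonneg (Nat.cast_nonneg n) (η.2.1 x)), (Nat.lt_floor_add_one _).le⟩
  choose b hb1 hb2 using fun j => exists_barycentre μ (S j) (K j) (hK j) (hKc j) (hS j) (hSK j)
  refine ⟨b, fun η x => ?_, fun x => ?_⟩
  · have h1 := hb1 (gridIndex n η) ⟨η, rfl⟩ x
    have h2 := hSK (gridIndex n η) η rfl x
    change (n : ℝ) * (b (gridIndex n η)).1 x ∈ _ at h1
    rw [← abs_of_nonneg (Nat.cast_nonneg (α := ℝ) n), ← abs_mul, mul_sub, abs_le]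
    exact ⟨by linarith [h1.1, h2.2], by linarith [h1.2, h2.1]⟩
  · have h1 : ∀ j, (μ.map (gridIndex n)).real {j} = μ.real (S j) := fun j => by
      rw [map_measureReal_apply (measurable_gridIndex n) (measurableSet_singleton j)]
    have hint : Integrable (fun η : Simplex q => (η : Fin q → ℝ) x) μ := by
      refine Integrable.of_bound (continuous_simplex_apply x).aestronglyMeasurable 1
        (Eventually.of_forall fun η => ?_)
      rw [Real.norm_of_nonneg (simplex_nonneg η x)]
      exact simplex_le_one η x
    simp only [h1, hb2]
    rw [← integral_iUnion_fintype hS ?_ fun j => hint.integrableOn, ← Set.preimage_iUnion,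
      Set.iUnion_of_singleton, Set.preimage_univ, setIntegral_univ]
    intro i j hij
    exact Disjoint.preimage _ (by simpa using hij)

lemma tendsto_integral_comp {X : Type*} [TopologicalSpace X] [CompactSpace X] [MeasurableSpace X]
    [OpensMeasurableSpace X] (μ : Measure X) [IsFiniteMeasure μ] {f : X → ℝ} (hf : Continuous f)
    {Φ : ℕ → X → X} (hΦ : ∀ n, Measurable (Φ n)) (hlim : ∀ x, Tendsto (Φ · x) atTop (𝓝 x)) :
    Tendsto (fun n => ∫ x, f (Φ n x) ∂μ) atTop (𝓝 (∫ x, f x ∂μ)) := by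
  obtain ⟨C, hC⟩ := isCompact_univ.exists_bound_of_continuousOn hf.continuousOn
  exact tendsto_integral_of_dominated_convergence (fun _ => C)
    (fun n => (hf.measurable.comp (hΦ n)).aestronglyMeasurable) (integrable_const C)
    (fun n => Eventually.of_forall fun x => hC _ (Set.mem_univ _))
    (Eventually.of_forall fun x => (hf.tendsto x).comp (hlim x))

lemma continuous_edgeTerm (π : Matrix (Fin q) (Fin q) ℝ) :
    Continuous fun p : Simplex q × Simplex q => edgeTerm π p.1 p.2 := by
  have h : Continuous fun p : Simplex q × Simplex q =>
      edgeSum π p.1 p.2 / edgeSum π (unif q) (unif q) :=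
    (continuous_finsetSum _ fun x _ => continuous_finsetSum _ fun y _ =>
      (((continuous_simplex_apply x).comp continuous_fst).mul
        ((continuous_simplex_apply y).comp continuous_snd)).mul continuous_const).div_const _
  simp only [edgeTerm, neg_mul]
  exact (Real.continuous_mul_log.comp h).neg

lemma continuous_vertexTerm (π : Matrix (Fin q) (Fin q) ℝ) (n : ℕ) :
    Continuous fun η : Fin n → Simplex q => vertexTerm π (fun i => (η i : Fin q → ℝ)) := by
  have h : Continuous fun η : Fin n → Simplex q =>
      vertexSum π (fun i => (η i : Fin q → ℝ)) / vertexSum π (fun _ : Fin n => unif q) :=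
    (continuous_finsetSum _ fun x _ => continuous_finsetProd _ fun i _ =>
      continuous_finsetSum _ fun y _ => ((continuous_simplex_apply y).comp
        (continuous_apply i : Continuous fun η : Fin n → Simplex q => η i)).mul
          continuous_const).div_const _
  simp only [vertexTerm, neg_mul]
  exact (Real.continuous_mul_log.comp h).neg

/-- A consistent distribution with negative complexity can be replaced by a finite channel. -/
lemma exists_channel_of_complexity_neg [NeZero q] {p : Matrix (Fin q) (Fin q) ℝ≥0}
    (hp : IsSymmStochastic p) (k : ℕ) {Q : ProbabilityMeasure (Simplex q)} (hQ : IsConsistent Q)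
    (hneg : complexity k (realMatrix p) Q < 0) :
    ∃ R, IsChannel R ∧ channelComplexity k p R < 0 := by
  set μ : Measure (Simplex q) := (Q : Measure (Simplex q)) with hμ
  choose b hb1 hb2 using fun n => exists_grid_barycentres μ n
  set φ : ℕ → Simplex q → Simplex q := fun n η => b n (gridIndex n η) with hφ
  have hφm : ∀ n, Measurable (φ n) := fun n =>
    (measurable_of_finite (b n)).comp (measurable_gridIndex n)
  have hφl : ∀ η, Tendsto (φ · η) atTop (𝓝 η) := by
    intro η
    rw [tendsto_subtype_rng, tendsto_pi_nhds]
    intro x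
    rw [tendsto_iff_norm_sub_tendsto_zero]
    refine squeeze_zero' (Eventually.of_forall fun n => norm_nonneg _) ?_
      tendsto_one_div_atTop_nhds_zero_nat
    filter_upwards [eventually_gt_atTop 0] with n hn
    have hn' : (0 : ℝ) < n := Nat.cast_pos.2 hn
    rw [le_div_iff₀ hn', mul_comm]
    exact hb1 n η x
  have hedge := tendsto_integral_comp (μ.prod μ) (continuous_edgeTerm (realMatrix p))
    (Φ := fun n => Prod.map (φ n) (φ n)) (fun n => (hφm n).prodMap (hφm n))
    (fun x => (hφl x.1).prodMk_nhds (hφl x.2))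
  have hvert := tendsto_integral_comp (Measure.pi fun _ : Fin (k + 1) => μ)
    (continuous_vertexTerm (realMatrix p) (k + 1)) (Φ := fun n η i => φ n (η i))
    (fun n => measurable_pi_lambda _ fun i => (hφm n).comp (measurable_pi_apply i))
    (fun η => tendsto_pi_nhds.2 fun i => hφl (η i))
  have hlim := (hedge.const_mul (-(((k : ℝ) + 1) / 2))).add hvert
  obtain ⟨n, hn⟩ := (hlim.eventually_lt_const hneg).exists
  set ν := μ.map (gridIndex n) with hν
  have : IsProbabilityMeasure ν := Measure.isProbabilityMeasure_map
    (measurable_gridIndex n).aemeasurable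
  refine ⟨discreteChannel (fun j => ν.real {j}) (b n),
    isChannel_discreteChannel (fun j => measureReal_nonneg) fun x => ?_, ?_⟩
  · rw [hb2 n x]; exact hQ x
  have hedge_eq : ∑ i : (Fin q → Fin (n + 1)) × (Fin q → Fin (n + 1)),
      ν.real {i.1} * ν.real {i.2} * edgeTerm (realMatrix p) (b n i.1) (b n i.2) =
      ∫ x, edgeTerm (realMatrix p) (Prod.map (φ n) (φ n) x).1 (Prod.map (φ n) (φ n) x).2
        ∂μ.prod μ := by
    have h1 : ∫ x, edgeTerm (realMatrix p) (Prod.map (φ n) (φ n) x).1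
        (Prod.map (φ n) (φ n) x).2 ∂μ.prod μ =
        ∫ j, edgeTerm (realMatrix p) (b n j.1) (b n j.2) ∂ν.prod ν := by
      rw [hν, Measure.map_prod_map μ μ (measurable_gridIndex n) (measurable_gridIndex n),
        integral_map ((measurable_gridIndex n).prodMap (measurable_gridIndex n)).aemeasurable
          (measurable_of_finite _).aestronglyMeasurable]
      rfl
    rw [h1, integral_fintype (Integrable.of_finite)]
    refine Finset.sum_congr rfl fun j _ => ?_
    rw [show ({j} : Set _) = {j.1} ×ˢ {j.2} from Set.singleton_prod_singleton.symm,
      measureReal_prod_prod, smul_eq_mul]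
  have hvert_eq : ∑ a : Fin (k + 1) → Fin q → Fin (n + 1), (∏ i, ν.real {a i}) *
        vertexTerm (realMatrix p) (fun i => (b n (a i) : Fin q → ℝ)) =
      ∫ η, vertexTerm (realMatrix p) (fun i => (φ n (η i) : Fin q → ℝ))
        ∂(Measure.pi fun _ : Fin (k + 1) => μ) := by
    have h1 : ∫ η, vertexTerm (realMatrix p) (fun i => (φ n (η i) : Fin q → ℝ))
        ∂(Measure.pi fun _ : Fin (k + 1) => μ) =
        ∫ a, vertexTerm (realMatrix p) (fun i => (b n (a i) : Fin q → ℝ))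
          ∂(Measure.pi fun _ : Fin (k + 1) => ν) := by
      rw [hν, ← Measure.pi_map_pi fun _ => (measurable_gridIndex n).aemeasurable,
        integral_map _ (measurable_of_finite _).aestronglyMeasurable]
      exact (measurable_pi_lambda _ fun i =>
        (measurable_gridIndex n).comp (measurable_pi_apply i)).aemeasurable
    rw [h1, integral_fintype (Integrable.of_finite)]
    refine Finset.sum_congr rfl fun a _ => ?_
    rw [Measure.real, Measure.pi_singleton, ENNReal.toReal_prod, smul_eq_mul]
    rfl
  rw [channelComplexity_discreteChannel hp, hedge_eq, hvert_eq]
  exact hn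

/-! ### Reconstruction and the Potts kernel -/

theorem reconstructionSolvable_of_complexity_neg (k : ℕ) {π : Matrix (Fin q) (Fin q) ℝ}
    (hπ : IsReversibleChannel π) (hfr : IsFrustrated π) {Q : ProbabilityMeasure (Simplex q)}
    (hQ : IsConsistent Q) (hneg : complexity k π Q < 0) : ReconstructionSolvable k π := by
  have hq : q ≠ 0 := by
    rintro rfl
    obtain ⟨η⟩ := Q.nonempty
    simpa using η.2.2
  have : NeZero q := ⟨hq⟩
  obtain ⟨p, rfl⟩ : ∃ p : Matrix (Fin q) (Fin q) ℝ≥0, realMatrix p = π :=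
    ⟨fun x y => ⟨π x y, hπ.nonneg x y⟩, rfl⟩
  have hp : IsSymmStochastic p := ⟨hπ.sum_eq_one, fun x y => NNReal.eq (hπ.symm x y)⟩
  obtain ⟨c, hc, hle⟩ := exists_le_rootMutualInfo_iterate hp hfr k
    (exists_channel_of_complexity_neg hp k hQ hneg)
  have hlim := tendsto_atTop_ciInf (antitone_rootMutualInfo_iterate hp k)
    ⟨c, by rintro _ ⟨l, rfl⟩; exact hle l⟩
  have hlog : 0 < Real.log 2 := Real.log_pos one_lt_two
  refine ⟨_, div_pos (hc.trans_le (le_ciInf hle)) hlog, ?_⟩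
  exact (hlim.div_const (Real.log 2)).congr fun l => (rootInfo_eq hp k l).symm

lemma isReversibleChannel_pottsChannel {ε : ℝ} (hq : 2 ≤ q) (h0 : 0 ≤ ε) (h1 : ε ≤ 1) :
    IsReversibleChannel (pottsChannel q ε) where
  nonneg x y := by
    have : (2 : ℝ) ≤ q := by exact_mod_cast hq
    unfold pottsChannel
    split_ifs
    · linarith
    · exact div_nonneg h0 (by linarith)
  sum_eq_one x := by
    have hq' : (2 : ℝ) ≤ q := by exact_mod_cast hq
    have h : (q : ℝ) - 1 ≠ 0 := by linarith
    unfold pottsChannel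
    rw [← Finset.add_sum_erase _ _ (Finset.mem_univ x), if_pos rfl,
      Finset.sum_congr rfl fun y hy => if_neg (Finset.ne_of_mem_erase hy), Finset.sum_const,
      Finset.card_erase_of_mem (Finset.mem_univ x), Finset.card_univ, Fintype.card_fin,
      nsmul_eq_mul, Nat.cast_sub (by omega), Nat.cast_one, mul_div_cancel₀ _ h]
    ring
  symm x y := by simp only [pottsChannel, eq_comm]

/-- The antiferromagnetic Potts kernel is a constant minus a positive multiple of the identity. -/
lemma isFrustrated_pottsChannel {ε : ℝ} (hq : 2 ≤ q) (h : 1 - 1 / (q : ℝ) < ε) :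
    IsFrustrated (pottsChannel q ε) := by
  have hq' : (2 : ℝ) ≤ q := by exact_mod_cast hq
  have hq1 : (0 : ℝ) < q - 1 := by linarith
  have hpos : 0 < ε / ((q : ℝ) - 1) - (1 - ε) := by
    rw [sub_pos, lt_div_iff₀ hq1]
    have : ((1 : ℝ) - 1 / q) * q < ε * q := by gcongr
    rw [sub_mul, one_div_mul_cancel (by linarith)] at this
    linarith
  refine ⟨ε / ((q : ℝ) - 1), Matrix.diagonal fun _ => ε / ((q : ℝ) - 1) - (1 - ε),
    Matrix.PosDef.diagonal fun _ => hpos, fun x y => ?_⟩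
  rcases eq_or_ne y x with rfl | hxy
  · simp [pottsChannel]
  · simp [pottsChannel, hxy, hxy.symm]

end TreeReconstruction

end

theorem mainTheorem4 (q k : ℕ) (hk : 1 ≤ k) :
    (∀ π : Matrix (Fin q) (Fin q) ℝ,
      TreeReconstruction.IsReversibleChannel π →
      TreeReconstruction.IsFrustrated π →
      (∃ Q : MeasureTheory.ProbabilityMeasure (TreeReconstruction.Simplex q),
        TreeReconstruction.IsConsistent Q ∧ TreeReconstruction.complexity k π Q < 0) →
      TreeReconstruction.ReconstructionSolvable k π) ∧
    (∀ ε : ℝ, 2 ≤ q → 1 - 1 / (q : ℝ) < ε → ε ≤ 1 →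
      TreeReconstruction.IsReversibleChannel (TreeReconstruction.pottsChannel q ε) ∧
      TreeReconstruction.IsFrustrated (TreeReconstruction.pottsChannel q ε)) := by
  refine ⟨fun π hπ hfr ⟨Q, hQ, hneg⟩ =>
    TreeReconstruction.reconstructionSolvable_of_complexity_neg k hπ hfr hQ hneg,
    fun ε hq h h1 => ⟨TreeReconstruction.isReversibleChannel_pottsChannel hq ?_ h1,
      TreeReconstruction.isFrustrated_pottsChannel hq h⟩⟩
  have hq' : (1 : ℝ) ≤ q := by exact_mod_cast (by omega : 1 ≤ q)
  have : 1 / (q : ℝ) ≤ 1 := by rw [div_le_one (by linarith)]; exact hq'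
  linarith
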